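/- Let $k$ be an algebraically closed field of characteristic $0$ and let $A = k\langle x,y\rangle/(xy-yx-1)$ be the first Weyl algebra, $\mathbb{Z}$-graded by $\deg x = 1$, $\deg y = -1$. Let $\overline{A} = \bigoplus_{i,j\in\mathbb{Z}} \overline{A}_{ij}$, $\overline{A}_{ij} = A_{j-i}$, be the associated $\mathbb{Z}$-algebra (a ring without $1$, with products $\overline{A}_{ij}\overline{A}_{jl}\subseteq\overline{A}_{il}$ induced from $A$, and $\overline{A}_{ij}\overline{A}_{j'l}=0$ for $j\neq j'$). Let $\operatorname{Aut}(\overline{A})$ be the group of automorphisms of the $\mathbb{Z}$-algebra $\overline{A}$, i.e. of $k$-linear ring automorphisms $\gamma$ for which there is a permutation $\sigma$ of $\mathbb{Z}$ with $\gamma(\overline{A}_{ij}) = \overline{A}_{\sigma(i)\sigma(j)}$ for all $i,j$. Let $\operatorname{gr-}A$ be the category of $\mathbb{Z}$-graded right $A$-modules with homomorphisms of degree $0$, identified with the category of unitary right $\overline{A}$-modules, and let $\operatorname{Pic}(\operatorname{gr-}A)$ be the group of $k$-linear autoequivalences of $\operatorname{gr-}A$ modulo natural isomorphism. Let $\pi:\operatorname{Aut}(\overline{A})\to\operatorname{Pic}(\operatorname{gr-}A)$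 be the homomorphism that sends $\gamma$ to the functor $M\mapsto M_\gamma$, where $M_\gamma = M$ as a vector space with $m\circ r = m\,\gamma^{-1}(r)$ for $r\in\overline{A}$. Call $\gamma$ inner if $\pi(\gamma)=1$. Let $\alpha$ be the canonical principal automorphism of $\overline{A}$, given by the identifications $\overline{A}_{ij}=A_{j-i}=\overline{A}_{i+1,j+1}$. Let $\omega:A\to A$ be the automorphism with $\omega(x)=y$ and $\omega(y)=-x$, and let $\overline{\omega}$ be the automorphism of $\overline{A}$ that it induces, mapping $a\in\overline{A}_{ij}=A_{j-i}$ to $\omega(a)\in A_{i-j}=\overline{A}_{-i,-j}$. Write $\omega$ also for the induced autoequivalence of $\operatorname{gr-}A$: $(\omega M)_i=M_{-i}$, with $a\in A$ acting on $\omega M$ as $\omega^{-1}(a)$ acts on $M$. Let $\mathcal{S}_A$ be the shift functor $M\mapsto M\langle 1\rangle$, $M\langle1\rangle_i=M_{i-1}$. Let $m_{ij}\in\overline{A}_{ij}$ be $x^{j-i}$ if $j\ge i$ and $y^{i-j}$ if $j<i$. Then $\overline{\omega}(m_{ij}) = m_{-i,-j}$ if $j\ge i$ and $\overline{\omega}(m_{ij})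 = (-1)^{i-j}m_{-i,-j}$ if $j<i$, and the group $\operatorname{Aut}(\overline{A})$ is generated by the inner automorphisms together with $\alpha$ and $\overline{\omega}$. Moreover $$\operatorname{im}(\pi) = \langle \omega, \mathcal{S}_A\rangle\subseteq\operatorname{Pic}(\operatorname{gr-}A),$$ and $\langle\omega,\mathcal{S}_A\rangle$ is isomorphic to the infinite dihedral group $D_\infty$. -/

import Mathlib

open CategoryTheory

universe u

noncomputable section

namespace WeylPic

/-! ### The `ℤ`-algebra of a graded ring -/

section ZAlgebra

variable {k R : Type u} [CommRing k] [Ring R] [Algebra k R] (𝒜 : ℤ → Submodule k R)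

/-- The underlying `k`-module of the `ℤ`-algebra associated to the graded ring `R = ⨁ d, 𝒜 d`:
the direct sum over `(i, j) ∈ ℤ × ℤ` of the components `𝒜 (j - i)`. -/
def ZAlg : Type u := DirectSum (ℤ × ℤ) (fun p => 𝒜 (p.2 - p.1))

namespace ZAlg

instance : AddCommGroup (ZAlg 𝒜) :=
  inferInstanceAs (AddCommGroup (DirectSum (ℤ × ℤ) (fun p => 𝒜 (p.2 - p.1))))

instance : Module k (ZAlg 𝒜) :=
  inferInstanceAs (Module k (DirectSum (ℤ × ℤ) (fun p => 𝒜 (p.2 - p.1))))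

/-- The inclusion of the component with index `(i, j)`. -/
def of (i j : ℤ) : 𝒜 (j - i) →ₗ[k] ZAlg 𝒜 :=
  DirectSum.lof k (ℤ × ℤ) (fun p => 𝒜 (p.2 - p.1)) (i, j)

/-- The projection to the component with index `(i, j)`. -/
def proj (i j : ℤ) : ZAlg 𝒜 →ₗ[k] 𝒜 (j - i) :=
  DirectSum.component k (ℤ × ℤ) (fun p => 𝒜 (p.2 - p.1)) (i, j)

/-- The linear map out of the `ℤ`-algebra with given restrictions to the components. -/
def lift {N : Type u} [AddCommGroup N] [Module k N] (f : ∀ i j : ℤ, 𝒜 (j - i) →ₗ[k] N) :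
    ZAlg 𝒜 →ₗ[k] N :=
  DirectSum.toModule k (ℤ × ℤ) N (fun p => f p.1 p.2)

variable {𝒜}

@[simp] theorem lift_of {N : Type u} [AddCommGroup N] [Module k N]
    (f : ∀ i j : ℤ, 𝒜 (j - i) →ₗ[k] N) (i j : ℤ) (a : 𝒜 (j - i)) :
    lift 𝒜 f (of 𝒜 i j a) = f i j a :=
  DirectSum.toModule_lof (M := fun p : ℤ × ℤ => 𝒜 (p.2 - p.1)) k (i, j) a

@[simp] theorem proj_of (i j : ℤ) (a : 𝒜 (j - i)) : proj 𝒜 i j (of 𝒜 i j a) = a :=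
  DirectSum.component.lof_self (M := fun p : ℤ × ℤ => 𝒜 (p.2 - p.1)) k (i, j) a

theorem proj_of_ne {i j i' j' : ℤ} (a : 𝒜 (j - i)) (h : ¬ (i = i' ∧ j = j')) :
    proj 𝒜 i' j' (of 𝒜 i j a) = 0 := by
  have := DirectSum.component.of (M := fun p : ℤ × ℤ => 𝒜 (p.2 - p.1)) k (i', j') (i, j) a
  rw [dif_neg] at this
  · exact this
  · simpa [Prod.ext_iff] using h

theorem of_injective (i j : ℤ) : Function.Injective (of 𝒜 i j) :=
  Function.LeftInverse.injective (proj_of i j)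

theorem of_congr {i j i' j' : ℤ} (hi : i = i') (hj : j = j') (a : 𝒜 (j - i)) (b : 𝒜 (j' - i'))
    (h : (a : R) = b) : of 𝒜 i j a = of 𝒜 i' j' b := by
  subst hi hj
  rw [Subtype.ext h]

@[elab_as_elim]
theorem induction {P : ZAlg 𝒜 → Prop} (h0 : P 0) (hof : ∀ i j a, P (of 𝒜 i j a))
    (hadd : ∀ x y, P x → P y → P (x + y)) (x : ZAlg 𝒜) : P x :=
  DirectSum.induction_on (motive := P) x h0 (fun p a => hof p.1 p.2 a) hadd

variable [SetLike.GradedMonoid 𝒜]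

/-- The unit `1 ∈ 𝒜 (i - i)` of the diagonal component with index `(i, i)`. -/
def unit (i : ℤ) : 𝒜 (i - i) := ⟨1, by rw [sub_self]; exact SetLike.GradedOne.one_mem⟩

/-- The product of elements of the components with indices `(i, j)` and `(j, l)`. -/
def compMul {i j l : ℤ} (a : 𝒜 (j - i)) (b : 𝒜 (l - j)) : 𝒜 (l - i) :=
  ⟨(a : R) * b, by
    have := SetLike.GradedMul.mul_mem a.2 b.2
    rwa [add_comm, sub_add_sub_cancel] at this⟩

@[simp] theorem coe_unit (i : ℤ) : ((unit i : 𝒜 (i - i)) : R) = 1 := rfl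

@[simp] theorem coe_compMul {i j l : ℤ} (a : 𝒜 (j - i)) (b : 𝒜 (l - j)) :
    ((compMul a b : 𝒜 (l - i)) : R) = (a : R) * b := rfl

/-- The product of two homogeneous elements, with indices `(i, j)` and `(j', l)`: it is their
product in `R`, placed in the component with index `(i, l)`, if `j = j'`, and zero otherwise. -/
def mulOf (i j j' l : ℤ) : 𝒜 (j - i) →ₗ[k] 𝒜 (l - j') →ₗ[k] ZAlg 𝒜 :=
  LinearMap.mk₂ k
    (fun a b => if h : j = j' then of 𝒜 i l (compMul a (h ▸ b)) else 0)
    (by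
      intro a a' b
      split_ifs with h
      · subst h
        rw [← map_add]
        exact congrArg _ (Subtype.ext (add_mul _ _ _))
      · simp)
    (by
      intro c a b
      split_ifs with h
      · subst h
        rw [← map_smul]
        exact congrArg _ (Subtype.ext (smul_mul_assoc _ _ _))
      · simp)
    (by
      intro a b b'
      split_ifs with h
      · subst h
        rw [← map_add]
        exact congrArg _ (Subtype.ext (mul_add _ _ _))
      · simp)
    (by
      intro c a b
      split_ifs with h
      · subst h
        rw [← map_smul]
        exact congrArg _ (Subtype.ext (mul_smul_comm _ _ _))
      · simp)

/-- The multiplication of the `ℤ`-algebra, as a bilinear map. -/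
def mulHom : ZAlg 𝒜 →ₗ[k] ZAlg 𝒜 →ₗ[k] ZAlg 𝒜 :=
  lift 𝒜 fun i j => (lift 𝒜 fun j' l => (mulOf i j j' l).flip).flip

instance : Mul (ZAlg 𝒜) := ⟨fun x y => mulHom x y⟩

theorem mul_def (x y : ZAlg 𝒜) : x * y = mulHom x y := rfl

theorem of_mul_of {i j l : ℤ} (a : 𝒜 (j - i)) (b : 𝒜 (l - j)) :
    of 𝒜 i j a * of 𝒜 j l b = of 𝒜 i l (compMul a b) := by
  simp [mul_def, mulHom, mulOf]

theorem of_mul_of_ne {i j j' l : ℤ} (h : j ≠ j') (a : 𝒜 (j - i)) (b : 𝒜 (l - j')) :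
    of 𝒜 i j a * of 𝒜 j' l b = 0 := by
  simp [mul_def, mulHom, mulOf, h]

instance : NonUnitalRing (ZAlg 𝒜) where
  left_distrib x y z := by simp [mul_def]
  right_distrib x y z := by simp [mul_def]
  zero_mul x := by simp [mul_def]
  mul_zero x := by simp [mul_def]
  mul_assoc x y z := by
    induction x using induction with
    | h0 => simp [mul_def]
    | hadd x x' h h' => simp only [mul_def, map_add, LinearMap.add_apply] at *; rw [h, h']
    | hof i j a =>
    induction y using induction with
    | h0 => simp [mul_def]
    | hadd x x' h h' => simp only [mul_def, map_add, LinearMap.add_apply] at *; rw [h, h']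
    | hof j' l b =>
    induction z using induction with
    | h0 => simp [mul_def]
    | hadd x x' h h' => simp only [mul_def, map_add] at *; rw [h, h']
    | hof l' m c =>
    have z1 : ∀ w : ZAlg 𝒜, 0 * w = 0 := fun w => by simp [mul_def]
    have z2 : ∀ w : ZAlg 𝒜, w * 0 = 0 := fun w => by simp [mul_def]
    by_cases h1 : j = j'
    · subst h1
      by_cases h2 : l = l'
      · subst h2
        simp only [of_mul_of]
        exact congrArg _ (Subtype.ext (mul_assoc _ _ _))
      · rw [of_mul_of, of_mul_of_ne h2, of_mul_of_ne h2, z2]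
    · rw [of_mul_of_ne h1, z1]
      by_cases h2 : l = l'
      · subst h2
        rw [of_mul_of, of_mul_of_ne h1]
      · rw [of_mul_of_ne h2, z2]

instance : IsScalarTower k (ZAlg 𝒜) (ZAlg 𝒜) :=
  ⟨fun c x y => by simp [mul_def]⟩

instance : SMulCommClass k (ZAlg 𝒜) (ZAlg 𝒜) :=
  ⟨fun c x y => by simp [mul_def]⟩

end ZAlg

variable [SetLike.GradedMonoid 𝒜]

variable {𝒜} in
/-- `γ` is compatible with the permutation `σ` of `ℤ` if it maps the component with index `(i, j)`
into the component with index `(σ i, σ j)`, for all `i` and `j`. -/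
def Permutes (γ : RingAut (ZAlg 𝒜)) (σ : Equiv.Perm ℤ) : Prop :=
  ∀ (i j : ℤ) (a : 𝒜 (j - i)), ∃ b : 𝒜 (σ j - σ i), γ (ZAlg.of 𝒜 i j a) = ZAlg.of 𝒜 (σ i) (σ j) b

variable {𝒜} in
theorem permutes_inv {γ : RingAut (ZAlg 𝒜)} {σ : Equiv.Perm ℤ} (h : Permutes γ σ) :
    Permutes γ⁻¹ σ⁻¹ := by
  intro i j a
  have key : ∀ x : ZAlg 𝒜, γ x = ZAlg.of 𝒜 i j a →
      x = ZAlg.of 𝒜 (σ⁻¹ i) (σ⁻¹ j) (ZAlg.proj 𝒜 (σ⁻¹ i) (σ⁻¹ j) x) := by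
    intro x hx
    have gen : ∀ x : ZAlg 𝒜, ZAlg.of 𝒜 i j (ZAlg.proj 𝒜 i j (γ x)) =
        γ (ZAlg.of 𝒜 (σ⁻¹ i) (σ⁻¹ j) (ZAlg.proj 𝒜 (σ⁻¹ i) (σ⁻¹ j) x)) := by
      intro x
      induction x using ZAlg.induction with
      | h0 => simp
      | hadd x y hx hy => simp only [map_add, hx, hy]
      | hof i' j' a' =>
      obtain ⟨b, hb⟩ := h i' j' a'
      by_cases h' : i' = σ⁻¹ i ∧ j' = σ⁻¹ j
      · obtain ⟨rfl, rfl⟩ := h'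
        rw [ZAlg.proj_of, hb]
        have e : ZAlg.of 𝒜 (σ (σ⁻¹ i)) (σ (σ⁻¹ j)) b = ZAlg.of 𝒜 i j ⟨b, by
            have := b.2
            have e : σ (σ⁻¹ j) - σ (σ⁻¹ i) = j - i :=
              congrArg₂ _ (σ.apply_symm_apply j) (σ.apply_symm_apply i)
            exact e ▸ this⟩ :=
          ZAlg.of_congr (by simp) (by simp) _ _ rfl
        rw [e, ZAlg.proj_of]
      · rw [hb, ZAlg.proj_of_ne, ZAlg.proj_of_ne _ h']
        · simp
        · rintro ⟨h1, h2⟩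
          exact h' ⟨by rw [← h1]; simp, by rw [← h2]; simp⟩
    apply γ.injective
    rw [← gen, hx, ZAlg.proj_of]
  exact ⟨_, key (γ⁻¹ (ZAlg.of 𝒜 i j a)) (γ.apply_symm_apply _)⟩

/-- The automorphism group of the `ℤ`-algebra associated to a graded ring: the `k`-linear ring
automorphisms that permute the components, compatibly with some permutation of the index set `ℤ`. -/
def ZAut : Subgroup (RingAut (ZAlg 𝒜)) where
  carrier := {γ | (∀ (c : k) (x : ZAlg 𝒜), γ (c • x) = c • γ x) ∧ ∃ σ : Equiv.Perm ℤ, Permutes γ σ}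
  one_mem' := ⟨fun _ _ => rfl, 1, fun _ _ a => ⟨a, rfl⟩⟩
  mul_mem' := by
    rintro γ δ ⟨hγ, σ, hσ⟩ ⟨hδ, τ, hτ⟩
    refine ⟨fun c x => by simp [hγ, hδ], σ * τ, fun i j a => ?_⟩
    obtain ⟨b, hb⟩ := hτ i j a
    obtain ⟨c, hc⟩ := hσ _ _ b
    exact ⟨c, by rw [RingAut.mul_apply, hb, hc]; rfl⟩
  inv_mem' := by
    rintro γ ⟨hγ, σ, hσ⟩
    refine ⟨fun c x => ?_, σ⁻¹, permutes_inv hσ⟩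
    apply γ.injective
    rw [hγ]
    simp only [RingAut.inv_apply, RingEquiv.apply_symm_apply]

/-- An automorphism of the `ℤ`-algebra, given through its components: a permutation `σ` of `ℤ` and
linear isomorphisms from the component `(i, j)` to the component `(σ i, σ j)` that respect units
and products. -/
structure CompAut where
  σ : Equiv.Perm ℤ
  φ : ∀ i j : ℤ, 𝒜 (j - i) ≃ₗ[k] 𝒜 (σ j - σ i)
  φ_one : ∀ i, φ i i (ZAlg.unit i) = ZAlg.unit (σ i)
  φ_mul : ∀ (i j l : ℤ) (a : 𝒜 (j - i)) (b : 𝒜 (l - j)),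
    φ i l (ZAlg.compMul a b) = ZAlg.compMul (φ i j a) (φ j l b)

namespace CompAut

variable {𝒜}

theorem φ_congr (T : CompAut 𝒜) {i j i' j' : ℤ} (hi : i = i') (hj : j = j')
    (a : 𝒜 (j - i)) (b : 𝒜 (j' - i')) (h : (a : R) = b) : (T.φ i j a : R) = T.φ i' j' b := by
  subst hi hj
  rw [Subtype.ext h]

/-- The inverse. -/
def symm (T : CompAut 𝒜) : CompAut 𝒜 where
  σ := T.σ⁻¹
  φ i j := (LinearEquiv.ofEq _ _ (by simp)).trans (T.φ (T.σ⁻¹ i) (T.σ⁻¹ j)).symm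
  φ_one i := by
    rw [LinearEquiv.trans_apply, LinearEquiv.symm_apply_eq, T.φ_one]
    rfl
  φ_mul i j l a b := by
    rw [LinearEquiv.trans_apply, LinearEquiv.symm_apply_eq, T.φ_mul]
    simp only [LinearEquiv.trans_apply, LinearEquiv.apply_symm_apply]
    rfl

theorem φ_symm_φ (T : CompAut 𝒜) {i j : ℤ} (a : 𝒜 (j - i)) :
    ((T.symm.φ _ _ (T.φ i j a)) : R) = a := by
  set b := T.symm.φ _ _ (T.φ i j a) with hb
  have h1 : T.φ _ _ b = LinearEquiv.ofEq _ _ (by simp [symm]) (T.φ i j a) := by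
    exact (T.φ _ _).apply_symm_apply _
  have hm : (b : R) ∈ 𝒜 (j - i) := by
    have := b.2
    simpa [symm] using this
  have h2 : ((T.φ i j ⟨b, hm⟩ : 𝒜 (T.σ j - T.σ i)) : R) = T.φ _ _ b :=
    T.φ_congr (by simp [symm]) (by simp [symm]) _ _ rfl
  rw [h1] at h2
  have h3 := (T.φ i j).injective (Subtype.ext h2 : T.φ i j ⟨b, hm⟩ = T.φ i j a)
  exact congrArg Subtype.val h3

theorem φ_φ_symm (T : CompAut 𝒜) {i j : ℤ} (a : 𝒜 (j - i)) :
    ((T.φ _ _ (T.symm.φ i j a)) : R) = a := by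
  exact congrArg Subtype.val ((T.φ _ _).apply_symm_apply (LinearEquiv.ofEq _ _ (by simp [symm]) a))

/-- The linear endomorphism of the `ℤ`-algebra given by the components. -/
def toLin (T : CompAut 𝒜) : ZAlg 𝒜 →ₗ[k] ZAlg 𝒜 :=
  ZAlg.lift 𝒜 fun i j => ZAlg.of 𝒜 (T.σ i) (T.σ j) ∘ₗ (T.φ i j).toLinearMap

theorem toLin_of (T : CompAut 𝒜) (i j : ℤ) (a : 𝒜 (j - i)) :
    T.toLin (ZAlg.of 𝒜 i j a) = ZAlg.of 𝒜 (T.σ i) (T.σ j) (T.φ i j a) := by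
  simp [toLin]

theorem toLin_mul (T : CompAut 𝒜) (x y : ZAlg 𝒜) : T.toLin (x * y) = T.toLin x * T.toLin y := by
  induction x using ZAlg.induction with
  | h0 => simp
  | hadd x x' h h' => simp only [add_mul, map_add, h, h']
  | hof i j a =>
  induction y using ZAlg.induction with
  | h0 => simp
  | hadd x x' h h' => simp only [mul_add, map_add, h, h']
  | hof j' l b =>
  by_cases h : j = j'
  · subst h
    rw [ZAlg.of_mul_of, toLin_of, toLin_of, toLin_of, ZAlg.of_mul_of, T.φ_mul]
  · rw [ZAlg.of_mul_of_ne h, toLin_of, toLin_of,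
      ZAlg.of_mul_of_ne (fun h' => h (T.σ.injective h')), map_zero]

theorem symm_toLin_toLin (T : CompAut 𝒜) (x : ZAlg 𝒜) : T.symm.toLin (T.toLin x) = x := by
  induction x using ZAlg.induction with
  | h0 => simp
  | hadd x x' h h' => simp only [map_add, h, h']
  | hof i j a =>
  rw [toLin_of, toLin_of]
  exact ZAlg.of_congr (by simp [symm]) (by simp [symm]) _ _ (T.φ_symm_φ a)

theorem toLin_symm_toLin (T : CompAut 𝒜) (x : ZAlg 𝒜) : T.toLin (T.symm.toLin x) = x := by
  induction x using ZAlg.induction with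
  | h0 => simp
  | hadd x x' h h' => simp only [map_add, h, h']
  | hof i j a =>
  rw [toLin_of, toLin_of]
  exact ZAlg.of_congr (by simp [symm]) (by simp [symm]) _ _ (T.φ_φ_symm a)

/-- The automorphism of the `ℤ`-algebra with the given components: it sends `a` in the component
`(i, j)` to `φ i j a` in the component `(σ i, σ j)`. -/
def toZAut (T : CompAut 𝒜) : ZAut 𝒜 :=
  ⟨{ toFun := T.toLin
     invFun := T.symm.toLin
     left_inv := T.symm_toLin_toLin
     right_inv := T.toLin_symm_toLin
     map_mul' := T.toLin_mul
     map_add' := map_add T.toLin },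
   fun c x => map_smul T.toLin c x, T.σ, fun i j a => ⟨_, T.toLin_of i j a⟩⟩

theorem toZAut_of (T : CompAut 𝒜) (i j : ℤ) (a : 𝒜 (j - i)) :
    (T.toZAut : RingAut (ZAlg 𝒜)) (ZAlg.of 𝒜 i j a) =
      ZAlg.of 𝒜 (T.σ i) (T.σ j) (T.φ i j a) :=
  T.toLin_of i j a

end CompAut

variable {𝒜}

theorem of_proj_of_permutes {γ : RingAut (ZAlg 𝒜)} {σ : Equiv.Perm ℤ} (h : Permutes γ σ)
    (i j : ℤ) (a : 𝒜 (j - i)) :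
    ZAlg.of 𝒜 (σ i) (σ j) (ZAlg.proj 𝒜 (σ i) (σ j) (γ (ZAlg.of 𝒜 i j a))) =
      γ (ZAlg.of 𝒜 i j a) := by
  obtain ⟨b, hb⟩ := h i j a
  rw [hb, ZAlg.proj_of]

/-- The components of an automorphism of the `ℤ`-algebra that is compatible with `σ`. -/
def compAut (γ : RingAut (ZAlg 𝒜)) (hγ : ∀ (c : k) (x : ZAlg 𝒜), γ (c • x) = c • γ x)
    (σ : Equiv.Perm ℤ) (h : Permutes γ σ) : CompAut 𝒜 where
  σ := σ
  φ i j := LinearEquiv.ofBijective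
    ({ toFun := fun a => ZAlg.proj 𝒜 (σ i) (σ j) (γ (ZAlg.of 𝒜 i j a))
       map_add' := fun a b => by simp only [map_add]
       map_smul' := fun c a => by simp only [map_smul, hγ, RingHom.id_apply] } :
      𝒜 (j - i) →ₗ[k] 𝒜 (σ j - σ i)) (by
    refine ⟨fun a b hab => ?_, fun b => ?_⟩
    · have hab' := congrArg (ZAlg.of 𝒜 (σ i) (σ j)) hab
      simp only [LinearMap.coe_mk, AddHom.coe_mk, of_proj_of_permutes h] at hab'
      exact ZAlg.of_injective i j (γ.injective hab')
    · obtain ⟨a, ha⟩ := permutes_inv h _ _ b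
      have hm : (a : R) ∈ 𝒜 (j - i) := by
        have := a.2
        simpa using this
      have e : ZAlg.of 𝒜 (σ⁻¹ (σ i)) (σ⁻¹ (σ j)) a = ZAlg.of 𝒜 i j ⟨a, hm⟩ :=
        ZAlg.of_congr (by simp) (by simp) _ _ rfl
      refine ⟨⟨a, hm⟩, ?_⟩
      simp only [LinearMap.coe_mk, AddHom.coe_mk]
      rw [← e, ← ha, RingAut.inv_apply, RingEquiv.apply_symm_apply, ZAlg.proj_of])
  φ_one i := by
    set e := ZAlg.proj 𝒜 (σ i) (σ i) (γ (ZAlg.of 𝒜 i i (ZAlg.unit i))) with he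
    have he' := of_proj_of_permutes h i i (ZAlg.unit i)
    obtain ⟨a, ha⟩ := permutes_inv h _ _ (ZAlg.unit (𝒜 := 𝒜) (σ i))
    have hm : (a : R) ∈ 𝒜 (i - i) := by
      have := a.2
      simpa using this
    have e1 : ZAlg.of 𝒜 (σ⁻¹ (σ i)) (σ⁻¹ (σ i)) a = ZAlg.of 𝒜 i i ⟨a, hm⟩ :=
      ZAlg.of_congr (by simp) (by simp) _ _ rfl
    have h1 : γ (ZAlg.of 𝒜 i i ⟨a, hm⟩) = ZAlg.of 𝒜 (σ i) (σ i) (ZAlg.unit (σ i)) := by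
      rw [← e1, ← ha, RingAut.inv_apply, RingEquiv.apply_symm_apply]
    apply ZAlg.of_injective
    have h2 : ZAlg.compMul (ZAlg.unit i) (⟨a, hm⟩ : 𝒜 (i - i)) = ⟨a, hm⟩ :=
      Subtype.ext (one_mul _)
    have h3 : ZAlg.compMul e (ZAlg.unit (σ i)) = e := Subtype.ext (mul_one _)
    change ZAlg.of 𝒜 _ _ e = _
    rw [← h3, ← ZAlg.of_mul_of, he', ← h1, ← map_mul, ZAlg.of_mul_of, h2]
  φ_mul i j l a b := by
    apply ZAlg.of_injective
    rw [← ZAlg.of_mul_of]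
    change ZAlg.of 𝒜 _ _ (ZAlg.proj 𝒜 _ _ (γ _)) = ZAlg.of 𝒜 _ _ (ZAlg.proj 𝒜 _ _ (γ _)) *
      ZAlg.of 𝒜 _ _ (ZAlg.proj 𝒜 _ _ (γ _))
    rw [of_proj_of_permutes h, ← ZAlg.of_mul_of, map_mul,
      of_proj_of_permutes h, of_proj_of_permutes h]

theorem of_compAut (γ : RingAut (ZAlg 𝒜)) (hγ : ∀ (c : k) (x : ZAlg 𝒜), γ (c • x) = c • γ x)
    (σ : Equiv.Perm ℤ) (h : Permutes γ σ) (i j : ℤ) (a : 𝒜 (j - i)) :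
    ZAlg.of 𝒜 (σ i) (σ j) ((compAut γ hγ σ h).φ i j a) = γ (ZAlg.of 𝒜 i j a) :=
  of_proj_of_permutes h i j a

variable (𝒜) in
/-- The components of the translation automorphism: the identity maps
from `𝒜 (j - i)`, as the component `(i, j)`, to itself, as the component `(i + n, j + n)`. -/
def shiftComp (n : ℤ) : CompAut 𝒜 where
  σ := Equiv.addRight n
  φ i j := LinearEquiv.ofEq _ _ (by simp)
  φ_one i := rfl
  φ_mul i j l a b := rfl

variable (𝒜) in
/-- The canonical principal automorphism `α` of the `ℤ`-algebra. -/
def alpha : ZAut 𝒜 := (shiftComp 𝒜 1).toZAut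

/-- The components of the map induced by an algebra automorphism `θ` of `R` that maps `𝒜 d` into
`𝒜 (-d)` for all `d`: the component `(i, j)` is mapped to the component `(-i, -j)` by `θ`. -/
def negComp (θ : R ≃ₐ[k] R) (h : ∀ d, ∀ a ∈ 𝒜 d, θ a ∈ 𝒜 (-d))
    (h' : ∀ d, ∀ a ∈ 𝒜 d, θ.symm a ∈ 𝒜 (-d)) : CompAut 𝒜 where
  σ := Equiv.neg ℤ
  φ i j :=
    { toFun := fun a => ⟨θ a, by
        have := h _ _ a.2
        simpa [add_comm, sub_eq_add_neg] using this⟩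
      invFun := fun a => ⟨θ.symm a, by
        have := h' _ _ a.2
        simpa [add_comm, sub_eq_add_neg] using this⟩
      left_inv := fun a => Subtype.ext (by simp)
      right_inv := fun a => Subtype.ext (by simp)
      map_add' := fun a b => Subtype.ext (by simp)
      map_smul' := fun c a => Subtype.ext (by simp) }
  φ_one i := Subtype.ext (map_one θ)
  φ_mul i j l a b := Subtype.ext (map_mul θ _ _)

end ZAlgebra

/-! ### Graded right modules -/

section Modules

variable {k R : Type u} [CommRing k] [Ring R] [Algebra k R] (𝒜 : ℤ → Submodule k R)
  [SetLike.GradedMonoid 𝒜]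

/-- A `ℤ`-graded right module over the graded ring `R = ⨁ d, 𝒜 d`, given by its homogeneous
components `M i` and the action maps `M i × 𝒜 (j - i) → M j`. -/
structure GrMod : Type (u + 1) where
  comp : ℤ → Type u
  [addCommGroup : ∀ i, AddCommGroup (comp i)]
  [module : ∀ i, Module k (comp i)]
  act : ∀ i j : ℤ, comp i →ₗ[k] 𝒜 (j - i) →ₗ[k] comp j
  act_one : ∀ (i : ℤ) (m : comp i), act i i m (ZAlg.unit i) = m
  act_mul : ∀ (i j l : ℤ) (m : comp i) (a : 𝒜 (j - i)) (b : 𝒜 (l - j)),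
    act j l (act i j m a) b = act i l m (ZAlg.compMul a b)

attribute [instance] GrMod.addCommGroup GrMod.module

namespace GrMod

variable {𝒜}

/-- A homomorphism of graded right modules, of degree zero. -/
@[ext]
structure Hom (M N : GrMod 𝒜) : Type u where
  app : ∀ i, M.comp i →ₗ[k] N.comp i
  map_act : ∀ (i j : ℤ) (m : M.comp i) (a : 𝒜 (j - i)),
    app j (M.act i j m a) = N.act i j (app i m) a

instance : Category (GrMod 𝒜) where
  Hom := Hom
  id M := ⟨fun _ => LinearMap.id, fun _ _ _ _ => rfl⟩
  comp f g := ⟨fun i => g.app i ∘ₗ f.app i, fun i j m a => by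
    simp [f.map_act, g.map_act]⟩

@[ext]
theorem hom_ext {M N : GrMod 𝒜} {f g : M ⟶ N} (h : ∀ i m, f.app i m = g.app i m) : f = g :=
  Hom.ext (funext fun i => LinearMap.ext (h i))

@[simp] theorem id_app (M : GrMod 𝒜) (i : ℤ) (m : M.comp i) : Hom.app (𝟙 M) i m = m := rfl

@[simp] theorem comp_app {M N P : GrMod 𝒜} (f : M ⟶ N) (g : N ⟶ P) (i : ℤ) (m : M.comp i) :
    Hom.app (f ≫ g) i m = g.app i (f.app i m) := rfl

variable {M N : GrMod 𝒜}

instance : Zero (M ⟶ N) := ⟨⟨fun _ => 0, fun _ _ _ _ => by simp⟩⟩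

instance : Add (M ⟶ N) :=
  ⟨fun f g => ⟨fun i => f.app i + g.app i, fun _ _ _ _ => by simp [f.map_act, g.map_act]⟩⟩

instance : Neg (M ⟶ N) := ⟨fun f => ⟨fun i => -f.app i, fun _ _ _ _ => by simp [f.map_act]⟩⟩

instance : AddCommGroup (M ⟶ N) where
  add_assoc f g h := hom_ext fun i m => add_assoc (f.app i m) (g.app i m) (h.app i m)
  zero_add f := hom_ext fun i m => zero_add (f.app i m)
  add_zero f := hom_ext fun i m => add_zero (f.app i m)
  add_comm f g := hom_ext fun i m => add_comm (f.app i m) (g.app i m)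
  neg_add_cancel f := hom_ext fun i m => neg_add_cancel (f.app i m)
  nsmul := nsmulRec
  zsmul := zsmulRec

@[simp] theorem add_app (f g : M ⟶ N) (i : ℤ) (m : M.comp i) :
    Hom.app (f + g) i m = f.app i m + g.app i m := rfl

instance : Module k (M ⟶ N) where
  smul c f := ⟨fun i => c • f.app i, fun _ _ _ _ => by simp [f.map_act]⟩
  one_smul f := hom_ext fun i m => one_smul k (f.app i m)
  mul_smul c d f := hom_ext fun i m => mul_smul c d (f.app i m)
  smul_zero c := hom_ext fun i m => smul_zero (A := N.comp i) c
  smul_add c f g := hom_ext fun i m => smul_add c (f.app i m) (g.app i m)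
  add_smul c d f := hom_ext fun i m => add_smul c d (f.app i m)
  zero_smul f := hom_ext fun i m => zero_smul k (f.app i m)

@[simp] theorem smul_app (c : k) (f : M ⟶ N) (i : ℤ) (m : M.comp i) :
    Hom.app (c • f) i m = c • f.app i m := rfl

instance : Preadditive (GrMod 𝒜) where
  add_comp _ _ _ f f' g := hom_ext fun i m => by simp
  comp_add _ _ _ f g g' := hom_ext fun i m => by simp

instance : Linear k (GrMod 𝒜) where
  smul_comp _ _ _ c f g := hom_ext fun i m => by simp
  comp_smul _ _ _ f c g := hom_ext fun i m => by simp

theorem act_congr (M : GrMod 𝒜) {i j : ℤ} (m : M.comp i) {a b : 𝒜 (j - i)} (h : (a : R) = b) :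
    M.act i j m a = M.act i j m b := by
  rw [Subtype.ext h]

/-- Transport between the components of equal indices, as multiplication by `1 ∈ R`. -/
def transport (M : GrMod 𝒜) {i j : ℤ} (h : i = j) : M.comp i →ₗ[k] M.comp j :=
  (M.act i j).flip ⟨1, by subst h; rw [sub_self]; exact SetLike.GradedOne.one_mem⟩

@[simp] theorem transport_rfl (M : GrMod 𝒜) {i : ℤ} (h : i = i) (m : M.comp i) :
    M.transport h m = m := M.act_one i m

@[simp] theorem transport_transport (M : GrMod 𝒜) {i j l : ℤ} (h : i = j) (h' : j = l)
    (m : M.comp i) : M.transport h' (M.transport h m) = M.transport (h.trans h') m := by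
  subst h h'
  simp

theorem transport_act (M : GrMod 𝒜) {i j i' j' : ℤ} (hi : i = i') (hj : j = j') (m : M.comp i)
    (a : 𝒜 (j - i)) (b : 𝒜 (j' - i')) (h : (a : R) = b) :
    M.transport hj (M.act i j m a) = M.act i' j' (M.transport hi m) b := by
  subst hi hj
  simpa using M.act_congr m h

theorem map_transport (f : M ⟶ N) {i j : ℤ} (h : i = j) (m : M.comp i) :
    f.app j (M.transport h m) = N.transport h (f.app i m) :=
  f.map_act i j m _

/-- An isomorphism from its components. -/
def mkIso (f : ∀ i, M.comp i →ₗ[k] N.comp i) (g : ∀ i, N.comp i →ₗ[k] M.comp i)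
    (hfg : ∀ i m, g i (f i m) = m) (hgf : ∀ i m, f i (g i m) = m)
    (h : ∀ (i j : ℤ) (m : M.comp i) (a : 𝒜 (j - i)),
      f j (M.act i j m a) = N.act i j (f i m) a) : M ≅ N where
  hom := ⟨f, h⟩
  inv := ⟨g, fun i j m a => by
    have := h i j (g i m) a
    rw [hgf] at this
    rw [← this, hfg]⟩
  hom_inv_id := hom_ext hfg
  inv_hom_id := hom_ext hgf

end GrMod

variable {𝒜}

/-- The functor that pulls graded modules back along an automorphism of the `ℤ`-algebra with
components `φ` and permutation `σ`: the component with index `i` of the new module is `M (σ i)`,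
and `a ∈ 𝒜 (j - i)` acts on it as `φ i j a` acts on `M (σ i)`. -/
def pull (T : CompAut 𝒜) : GrMod 𝒜 ⥤ GrMod 𝒜 where
  obj M :=
    { comp := fun i => M.comp (T.σ i)
      act := fun i j => (M.act (T.σ i) (T.σ j)).compl₂ (T.φ i j).toLinearMap
      act_one := fun i m => by
        change M.act _ _ m (T.φ i i (ZAlg.unit i)) = m
        rw [T.φ_one, M.act_one]
      act_mul := fun i j l m a b => by
        change M.act _ _ (M.act _ _ m (T.φ i j a)) (T.φ j l b) =
          M.act _ _ m (T.φ i l (ZAlg.compMul a b))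
        rw [T.φ_mul, M.act_mul] }
  map f := ⟨fun i => f.app (T.σ i), fun i j m a => f.map_act _ _ m _⟩
  map_id _ := rfl
  map_comp _ _ := rfl

theorem pull_act (T : CompAut 𝒜) (M : GrMod 𝒜) (i j : ℤ) (m : M.comp (T.σ i)) (a : 𝒜 (j - i)) :
    ((pull T).obj M).act i j m a = M.act (T.σ i) (T.σ j) m (T.φ i j a) := rfl

instance (T : CompAut 𝒜) : (pull T).Additive where
  map_add := rfl

instance (T : CompAut 𝒜) : (pull T).Linear k where
  map_smul _ _ := rfl

/-- Two pullback functors compose to a third one if the automorphisms do. -/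
def pullComp (S T U : CompAut 𝒜) (hσ : ∀ i, S.σ (T.σ i) = U.σ i)
    (hφ : ∀ i j a, (S.φ _ _ (T.φ i j a) : R) = U.φ i j a) : pull S ⋙ pull T ≅ pull U :=
  NatIso.ofComponents (fun M => GrMod.mkIso
    (M := (pull T).obj ((pull S).obj M)) (N := (pull U).obj M)
    (fun i => M.transport (hσ i)) (fun i => M.transport (hσ i).symm)
    (fun _ m => (M.transport_transport _ _ m).trans (M.transport_rfl _ m))
    (fun _ m => (M.transport_transport _ _ m).trans (M.transport_rfl _ m))
    (fun i j m a => M.transport_act (hσ i) (hσ j) m _ _ (hφ i j a)))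
    (fun {M _} f => GrMod.hom_ext fun i m =>
      (GrMod.map_transport f (hσ i) (show M.comp (S.σ (T.σ i)) from m)).symm)

variable (𝒜) in
/-- Pulling back along the identity. -/
def pullId : pull (shiftComp 𝒜 0) ≅ 𝟭 (GrMod 𝒜) :=
  NatIso.ofComponents (fun M => GrMod.mkIso
    (M := (pull (shiftComp 𝒜 0)).obj M) (N := M)
    (fun i => M.transport (add_zero i)) (fun i => M.transport (add_zero i).symm)
    (fun _ m => (M.transport_transport _ _ m).trans (M.transport_rfl _ m))
    (fun _ m => (M.transport_transport _ _ m).trans (M.transport_rfl _ m))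
    (fun i j m _ => M.transport_act (add_zero i) (add_zero j) m _ _ rfl))
    (fun {M _} f => GrMod.hom_ext fun i m =>
      (GrMod.map_transport f (add_zero i) (show M.comp (i + 0) from m)).symm)

/-- Pulling back along an automorphism is an equivalence. -/
def pullEquiv (T : CompAut 𝒜) : GrMod 𝒜 ≌ GrMod 𝒜 :=
  CategoryTheory.Equivalence.mk (pull T) (pull T.symm)
    ((pullId 𝒜).symm ≪≫ (pullComp T T.symm (shiftComp 𝒜 0)
      (fun i => by simp [CompAut.symm, shiftComp]) (fun i j a => T.φ_φ_symm a)).symm)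
    (pullComp T.symm T (shiftComp 𝒜 0)
      (fun i => by simp [CompAut.symm, shiftComp]) (fun i j a => T.φ_symm_φ a) ≪≫ pullId 𝒜)

instance (T : CompAut 𝒜) : (pull T).IsEquivalence := (pullEquiv T).isEquivalence_functor

end Modules

/-! ### The Picard group of a linear category -/

section Picard

universe v w

variable (k : Type u) [CommRing k] (C : Type w) [Category.{v} C] [Preadditive C] [Linear k C]

/-- The `k`-linear autoequivalences of `C`. -/
structure LinAutoeq where
  functor : C ⥤ C
  [isEquivalence : functor.IsEquivalence]
  [additive : functor.Additive]
  [linear : functor.Linear k]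

attribute [instance] LinAutoeq.isEquivalence LinAutoeq.additive LinAutoeq.linear

/-- Natural isomorphism of autoequivalences. -/
instance LinAutoeq.setoid : Setoid (LinAutoeq k C) where
  r F G := Nonempty (F.functor ≅ G.functor)
  iseqv := ⟨fun _ => ⟨Iso.refl _⟩, fun ⟨e⟩ => ⟨e.symm⟩, fun ⟨e⟩ ⟨e'⟩ => ⟨e ≪≫ e'⟩⟩

/-- The Picard group of `C`: the `k`-linear autoequivalences modulo natural isomorphism. The
product of the classes of `F` and `G` is the class of the composition `F ∘ G`. -/
def Pic : Type (max v w) := Quotient (LinAutoeq.setoid k C)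

variable {C} in
/-- The class of an autoequivalence in the Picard group. -/
def Pic.mk (F : C ⥤ C) [F.IsEquivalence] [F.Additive] [F.Linear k] : Pic k C :=
  Quotient.mk _ ⟨F⟩

instance : Group (Pic k C) where
  mul := Quotient.map₂ (fun F G => ⟨G.functor ⋙ F.functor⟩)
    (fun _ _ ⟨e⟩ _ _ ⟨e'⟩ => ⟨Functor.isoWhiskerRight e' _ ≪≫ Functor.isoWhiskerLeft _ e⟩)
  one := Pic.mk k (𝟭 C)
  inv := Quotient.map
    (fun F =>
      { functor := F.functor.asEquivalence.inverse
        additive := by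
          have : F.functor.asEquivalence.functor.Additive := F.additive
          infer_instance
        linear := by
          have : F.functor.asEquivalence.functor.Additive := F.additive
          have : F.functor.asEquivalence.functor.Linear k := F.linear
          infer_instance })
    (fun F G ⟨e⟩ => ⟨Iso.isoInverseOfIsoFunctor (G := F.functor.asEquivalence)
      (G' := G.functor.asEquivalence) e⟩)
  mul_assoc := by
    rintro ⟨F⟩ ⟨G⟩ ⟨H⟩
    rfl
  one_mul := by
    rintro ⟨F⟩
    exact Quotient.sound ⟨Functor.rightUnitor _⟩
  mul_one := by
    rintro ⟨F⟩
    exact Quotient.sound ⟨Functor.leftUnitor _⟩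
  inv_mul_cancel := by
    rintro ⟨F⟩
    exact Quotient.sound ⟨F.functor.asEquivalence.unitIso.symm⟩

theorem Pic.mk_eq_iff {F G : C ⥤ C} [F.IsEquivalence] [F.Additive] [F.Linear k]
    [G.IsEquivalence] [G.Additive] [G.Linear k] :
    Pic.mk k F = Pic.mk k G ↔ Nonempty (F ≅ G) :=
  ⟨fun h => Quotient.exact h, fun h => Quotient.sound h⟩

theorem Pic.mk_mul_mk {F G : C ⥤ C} [F.IsEquivalence] [F.Additive] [F.Linear k]
    [G.IsEquivalence] [G.Additive] [G.Linear k] :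
    Pic.mk k F * Pic.mk k G = Pic.mk k (G ⋙ F) := rfl

end Picard

/-! ### The homomorphism from automorphisms of the `ℤ`-algebra to the Picard group -/

section AutPic

variable {k R : Type u} [CommRing k] [Ring R] [Algebra k R] {𝒜 : ℤ → Submodule k R}
  [SetLike.GradedMonoid 𝒜]

theorem permutes_unique [Nontrivial R] {γ : RingAut (ZAlg 𝒜)} {σ τ : Equiv.Perm ℤ}
    (hσ : Permutes γ σ) (hτ : Permutes γ τ) : σ = τ := by
  ext i
  by_contra hne
  obtain ⟨b, hb⟩ := hσ i i (ZAlg.unit i)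
  obtain ⟨c, hc⟩ := hτ i i (ZAlg.unit i)
  have h0 : ZAlg.proj 𝒜 (σ i) (σ i) (ZAlg.of 𝒜 (τ i) (τ i) c) = 0 :=
    ZAlg.proj_of_ne c (fun h => hne h.1.symm)
  rw [← hc, hb, ZAlg.proj_of] at h0
  rw [h0, map_zero, map_eq_zero_iff _ γ.injective] at hb
  have h1 := (map_eq_zero_iff _ (ZAlg.of_injective i i)).1 hb
  exact one_ne_zero (congrArg Subtype.val h1 : (1 : R) = 0)

theorem GrMod.eq_zero_of_subsingleton [Subsingleton R] (M : GrMod 𝒜) (i : ℤ) (m : M.comp i) :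
    m = 0 := by
  rw [← M.act_one i m, show (ZAlg.unit i : 𝒜 (i - i)) = 0 from Subtype.ext (Subsingleton.elim _ _),
    map_zero]

/-- The twist functor `M ↦ M_γ` of an automorphism `γ` of the `ℤ`-algebra: the component of `M_γ`
with index `i` is the component `M (τ i)` of `M` on which `γ⁻¹ (1_i)` acts as the identity, where
`τ` is the permutation of `ℤ` induced by `γ⁻¹`, and `r` acts on `M_γ` as `γ⁻¹ r` acts on `M`. -/
def twist (γ : ZAut 𝒜) : GrMod 𝒜 ⥤ GrMod 𝒜 :=
  pull (compAut (γ⁻¹ : ZAut 𝒜).1 (γ⁻¹).2.1 (γ⁻¹).2.2.choose (γ⁻¹).2.2.choose_spec)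

instance (γ : ZAut 𝒜) : (twist γ).IsEquivalence := by unfold twist; infer_instance
instance (γ : ZAut 𝒜) : (twist γ).Additive := by unfold twist; infer_instance
instance (γ : ZAut 𝒜) : (twist γ).Linear k := by unfold twist; infer_instance

theorem twist_comp (γ δ : ZAut 𝒜) : Nonempty (twist δ ⋙ twist γ ≅ twist (γ * δ)) := by
  rcases subsingleton_or_nontrivial R with hR | hR
  · exact ⟨NatIso.ofComponents (fun M => GrMod.mkIso (fun _ => 0) (fun _ => 0)
      (fun i m => (GrMod.eq_zero_of_subsingleton _ i m).symm)
      (fun i m => (GrMod.eq_zero_of_subsingleton _ i m).symm)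
      (fun i j m a => by simp))
      (fun {M N} f => GrMod.hom_ext fun i m =>
        (GrMod.eq_zero_of_subsingleton _ i _).trans
          (GrMod.eq_zero_of_subsingleton _ i _).symm)⟩
  · have hγ := (γ⁻¹).2.2.choose_spec
    have hδ := (δ⁻¹).2.2.choose_spec
    have hγδ := ((γ * δ)⁻¹).2.2.choose_spec
    set σ := (γ⁻¹).2.2.choose
    set τ := (δ⁻¹).2.2.choose
    set ρ := ((γ * δ)⁻¹).2.2.choose
    have hc : Permutes ((γ * δ)⁻¹ : ZAut 𝒜).1 (τ * σ) := by
      intro i j a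
      obtain ⟨b, hb⟩ := hγ i j a
      obtain ⟨c, hc⟩ := hδ _ _ b
      refine ⟨c, ?_⟩
      rw [mul_inv_rev]
      change (δ⁻¹ : ZAut 𝒜).1 ((γ⁻¹ : ZAut 𝒜).1 _) = _
      rw [hb, hc]
      rfl
    have e : τ * σ = ρ := permutes_unique hc hγδ
    have eσ : ∀ i, τ (σ i) = ρ i := fun i => by rw [← e]; rfl
    refine ⟨pullComp _ _ _ eσ fun i j a => ?_⟩
    set S := compAut (δ⁻¹ : ZAut 𝒜).1 (δ⁻¹).2.1 τ hδ with hS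
    set T := compAut (γ⁻¹ : ZAut 𝒜).1 (γ⁻¹).2.1 σ hγ with hT
    set U := compAut ((γ * δ)⁻¹ : ZAut 𝒜).1 ((γ * δ)⁻¹).2.1 ρ hγδ with hU
    set b := T.φ i j a with hb
    have h1 : ZAlg.of 𝒜 (σ i) (σ j) b = (γ⁻¹ : ZAut 𝒜).1 (ZAlg.of 𝒜 i j a) :=
      of_compAut _ _ _ hγ i j a
    have h2 : ZAlg.of 𝒜 (τ (σ i)) (τ (σ j)) (S.φ (σ i) (σ j) b) =
        (δ⁻¹ : ZAut 𝒜).1 (ZAlg.of 𝒜 (σ i) (σ j) b) :=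
      of_compAut _ _ _ hδ _ _ b
    have h3 : ZAlg.of 𝒜 (ρ i) (ρ j) (U.φ i j a) =
        ((γ * δ)⁻¹ : ZAut 𝒜).1 (ZAlg.of 𝒜 i j a) :=
      of_compAut _ _ _ hγδ i j a
    have h4 : ((γ * δ)⁻¹ : ZAut 𝒜).1 (ZAlg.of 𝒜 i j a) =
        (δ⁻¹ : ZAut 𝒜).1 ((γ⁻¹ : ZAut 𝒜).1 (ZAlg.of 𝒜 i j a)) := by
      rw [mul_inv_rev]; rfl
    rw [h4, ← h1, ← h2] at h3
    have hm : ((S.φ (σ i) (σ j) b : 𝒜 _) : R) ∈ 𝒜 (ρ j - ρ i) := by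
      have := (S.φ (σ i) (σ j) b).2
      change _ ∈ 𝒜 (τ (σ j) - τ (σ i)) at this
      rwa [eσ, eσ] at this
    have h5 : ZAlg.of 𝒜 (τ (σ i)) (τ (σ j)) (S.φ (σ i) (σ j) b) =
        ZAlg.of 𝒜 (ρ i) (ρ j) ⟨_, hm⟩ := ZAlg.of_congr (eσ i) (eσ j) _ _ rfl
    rw [h5] at h3
    exact (congrArg Subtype.val (ZAlg.of_injective _ _ h3)).symm

variable (𝒜) in
/-- The homomorphism `γ ↦ (M ↦ M_γ)` from the automorphism group of the `ℤ`-algebra to the Picard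
group of the category of graded right modules. -/
def autToPic : ZAut 𝒜 →* Pic k (GrMod 𝒜) :=
  MonoidHom.mk' (fun γ => Pic.mk k (twist γ)) fun γ δ =>
    (Pic.mk_eq_iff k (GrMod 𝒜)).2 ⟨(twist_comp γ δ).some.symm⟩

variable (𝒜) in
/-- The class of the shift functor `M ↦ M⟨1⟩`, where `M⟨1⟩ i = M (i - 1)`. -/
def shiftPic : Pic k (GrMod 𝒜) := Pic.mk k (pull (shiftComp 𝒜 (-1)))

end AutPic

/-! ### The Weyl algebra -/

section Weyl

variable (k : Type u) [Field k]

/-- The letters `x` (for `true`) and `y` (for `false`) satisfy `x y - y x = 1`. -/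
inductive WeylRel : FreeAlgebra k Bool → FreeAlgebra k Bool → Prop
  | rel : WeylRel (FreeAlgebra.ι k true * FreeAlgebra.ι k false -
      FreeAlgebra.ι k false * FreeAlgebra.ι k true) 1

/-- The first Weyl algebra `k⟨x, y⟩ / (x y - y x - 1)`. -/
def Weyl : Type u := RingQuot (WeylRel k)

instance : Ring (Weyl k) := inferInstanceAs (Ring (RingQuot (WeylRel k)))

instance : Algebra k (Weyl k) := inferInstanceAs (Algebra k (RingQuot (WeylRel k)))

namespace Weyl

/-- The generators, `x` for `true` and `y` for `false`. -/
def gen (b : Bool) : Weyl k :=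
  (RingQuot.mkAlgHom k (WeylRel k) : FreeAlgebra k Bool →ₐ[k] Weyl k) (FreeAlgebra.ι k b)

/-- The generator `x`. -/
def x : Weyl k := gen k true

/-- The generator `y`. -/
def y : Weyl k := gen k false

theorem rel : gen k true * gen k false - gen k false * gen k true = 1 := by
  have := RingQuot.mkAlgHom_rel k (WeylRel.rel (k := k))
  rw [map_sub, map_mul, map_mul, map_one] at this
  exact this

variable {k}

/-- The algebra homomorphism from the Weyl algebra with given images of the generators. -/
def lift {B : Type u} [Ring B] [Algebra k B] (f : Bool → B)
    (h : f true * f false - f false * f true = 1) : Weyl k →ₐ[k] B :=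
  RingQuot.liftAlgHom k ⟨FreeAlgebra.lift k f, by rintro _ _ ⟨⟩; simpa using h⟩

@[simp] theorem lift_gen {B : Type u} [Ring B] [Algebra k B] (f : Bool → B)
    (h : f true * f false - f false * f true = 1) (b : Bool) : lift f h (gen k b) = f b :=
  (RingQuot.liftAlgHom_mkAlgHom_apply k _ _ _).trans (FreeAlgebra.lift_ι_apply _ _)

theorem algHom_ext {B : Type u} [Ring B] [Algebra k B] {f g : Weyl k →ₐ[k] B}
    (h : ∀ b, f (gen k b) = g (gen k b)) : f = g := by
  apply RingQuot.ringQuot_ext'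
  apply FreeAlgebra.hom_ext
  funext b
  exact h b

/-- The degrees of the generators: `deg x = 1` and `deg y = -1`. -/
def deg (b : Bool) : ℤ := if b then 1 else -1

variable (k) in
/-- The Euler grading: the component of degree `d` is spanned by the words in `x` and `y` of total
degree `d`. -/
def grading (d : ℤ) : Submodule k (Weyl k) :=
  Submodule.span k {a | ∃ w : List Bool, (w.map deg).sum = d ∧ a = (w.map (gen k)).prod}

instance : SetLike.GradedMonoid (grading k) where
  one_mem := Submodule.subset_span ⟨[], rfl, rfl⟩
  mul_mem := by
    intro i j a b ha hb
    have h : grading k i * grading k j ≤ grading k (i + j) := by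
      rw [grading, grading, Submodule.span_mul_span]
      apply Submodule.span_mono
      rintro _ ⟨_, ⟨v, hv, rfl⟩, _, ⟨w, hw, rfl⟩, rfl⟩
      exact ⟨v ++ w, by simp [hv, hw], by simp⟩
    exact h (Submodule.mul_mem_mul ha hb)

theorem gen_mem (b : Bool) : gen k b ∈ grading k (deg b) :=
  Submodule.subset_span ⟨[b], by simp, by simp⟩

theorem x_mem : x k ∈ grading k 1 := gen_mem true
theorem y_mem : y k ∈ grading k (-1) := gen_mem false

/-- The generators in the direct sum of the components. -/
def decomposeGen (b : Bool) : DirectSum ℤ (fun d => grading k d) :=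
  DirectSum.of (fun d => grading k d) (deg b) ⟨gen k b, gen_mem b⟩

theorem decomposeGen_rel : decomposeGen (k := k) true * decomposeGen (k := k) false -
    decomposeGen (k := k) false * decomposeGen (k := k) true = 1 := by
  have h : ∀ (a b : grading k 0), (a : Weyl k) - b = 1 →
      DirectSum.of (fun d => grading k d) 0 a - DirectSum.of (fun d => grading k d) 0 b = 1 := by
    intro a b hab
    have e : a = 1 + b := Subtype.ext (sub_eq_iff_eq_add.1 hab)
    rw [sub_eq_iff_eq_add, e, map_add]
    rfl
  unfold decomposeGen
  rw [DirectSum.of_mul_of, DirectSum.of_mul_of]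
  exact h _ _ (rel k)

/-- The Euler grading makes the Weyl algebra a graded algebra. -/
instance gradedAlgebra : GradedAlgebra (grading k) :=
  GradedAlgebra.ofAlgHom (grading k) (lift (decomposeGen (k := k)) decomposeGen_rel)
    (by
      apply algHom_ext
      intro b
      simp [decomposeGen])
    (by
      rintro d ⟨a, ha⟩
      have key : ∀ w : List Bool, lift (decomposeGen (k := k)) decomposeGen_rel (w.map (gen k)).prod =
          DirectSum.of (fun d => grading k d) ((w.map deg).sum)
            ⟨(w.map (gen k)).prod, Submodule.subset_span ⟨w, rfl, rfl⟩⟩ := by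
        intro w
        induction w with
        | nil => simp; rfl
        | cons b w ih =>
          simp only [List.map_cons, List.prod_cons, map_mul, ih, lift_gen]
          rw [decomposeGen, DirectSum.of_mul_of]
          rfl
      induction ha using Submodule.span_induction with
      | mem a h =>
        obtain ⟨w, rfl, rfl⟩ := h
        exact key w
      | zero =>
        exact (map_zero _).trans (map_zero (DirectSum.of (fun d => grading k d) d)).symm
      | add a b ha hb iha ihb =>
        refine (map_add _ a b).trans ?_
        rw [iha, ihb, ← map_add]
        rfl
      | smul c a ha iha =>
        refine (map_smul _ c a).trans ?_
        rw [iha]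
        exact (map_smul (DirectSum.lof k ℤ (fun d => grading k d) d) c ⟨a, ha⟩).symm)

/-- The automorphism `ω` of the Weyl algebra with `ω x = y` and `ω y = -x`. -/
def omega : Weyl k ≃ₐ[k] Weyl k :=
  AlgEquiv.ofAlgHom
    (lift (fun b => if b then y k else -x k) (by
      simp only [x, y, if_true, Bool.false_eq_true, if_false, mul_neg, neg_mul]
      rw [← rel k]
      abel))
    (lift (fun b => if b then -y k else x k) (by
      simp only [x, y, if_true, Bool.false_eq_true, if_false, mul_neg, neg_mul]
      rw [← rel k]
      abel))
    (algHom_ext fun b => by cases b <;> simp [x, y])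
    (algHom_ext fun b => by cases b <;> simp [x, y])

@[simp] theorem omega_x : omega (x k) = y k := by simp [omega, x]
@[simp] theorem omega_y : omega (y k) = -x k := by simp [omega, y]
@[simp] theorem omega_symm_x : omega.symm (x k) = -y k := by simp [omega, x]
@[simp] theorem omega_symm_y : omega.symm (y k) = x k := by simp [omega, y]

theorem map_mem_neg (f : Weyl k →ₐ[k] Weyl k) (hf : ∀ b, f (gen k b) ∈ grading k (-deg b))
    (d : ℤ) (a : Weyl k) (ha : a ∈ grading k d) : f a ∈ grading k (-d) := by
  have h : grading k d ≤ (grading k (-d)).comap f.toLinearMap := by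
    rw [grading, Submodule.span_le]
    rintro _ ⟨w, rfl, rfl⟩
    change f _ ∈ grading k _
    clear ha
    induction w with
    | nil => simpa using SetLike.GradedOne.one_mem (A := grading k)
    | cons b w ih =>
      simp only [List.map_cons, List.prod_cons, map_mul, List.sum_cons, neg_add]
      exact SetLike.GradedMul.mul_mem (hf b) ih
  exact h ha

theorem omega_mem (d : ℤ) (a : Weyl k) (ha : a ∈ grading k d) : omega a ∈ grading k (-d) := by
  refine map_mem_neg (omega (k := k)).toAlgHom (fun b => ?_) d a ha
  cases b
  · change omega (y k) ∈ _
    rw [omega_y]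
    exact neg_mem (by simpa [deg] using x_mem)
  · change omega (x k) ∈ _
    rw [omega_x]
    simpa [deg] using y_mem

theorem omega_symm_mem (d : ℤ) (a : Weyl k) (ha : a ∈ grading k d) :
    omega.symm a ∈ grading k (-d) := by
  refine map_mem_neg (omega (k := k)).symm.toAlgHom (fun b => ?_) d a ha
  cases b
  · change omega.symm (y k) ∈ _
    rw [omega_symm_y]
    simpa [deg] using x_mem
  · change omega.symm (x k) ∈ _
    rw [omega_symm_x]
    exact neg_mem (by simpa [deg] using y_mem)

variable (k)

/-- The automorphism `ω̄` of the `ℤ`-algebra of the Weyl algebra that is induced by `ω`. -/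
def omegaBar : ZAut (grading k) := (negComp omega omega_mem omega_symm_mem).toZAut

/-- The class of the autoequivalence `M ↦ ω M` of the category of graded right modules that is
induced by `ω`: the component of `ω M` with index `i` is `M (-i)`, and `a ∈ A` acts on `ω M` as
`ω⁻¹ a` acts on `M`. -/
def omegaPic : Pic k (GrMod (grading k)) :=
  Pic.mk k (pull (negComp omega.symm omega_symm_mem omega_mem))

/-- The canonical generator `m_{ij}` of the component of the `ℤ`-algebra with index `(i, j)` over
`k[xy]`: it is `x ^ (j - i)` if `i ≤ j`, and `y ^ (i - j)` if `j < i`. -/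
def m (i j : ℤ) : ZAlg (grading k) :=
  ZAlg.of (grading k) i j
    ⟨if i ≤ j then x k ^ (j - i).toNat else y k ^ (i - j).toNat, by
      split_ifs with h
      · have := SetLike.pow_mem_graded (A := grading k) (j - i).toNat x_mem
        simpa [h] using this
      · have := SetLike.pow_mem_graded (A := grading k) (i - j).toNat y_mem
        have e : (i - j).toNat • (-1 : ℤ) = j - i := by
          rw [nsmul_eq_mul, Int.toNat_of_nonneg (by omega)]; ring
        rwa [e] at this⟩

end Weyl

end Weyl

end WeylPic

end

noncomputable section

namespace WeylPic

/-! ### Pullback functors, scalar coboundaries, and classes in the Picard group -/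

section Scalars

variable {k R : Type u} [CommRing k] [Ring R] [Algebra k R] {𝒜 : ℤ → Submodule k R}
  [SetLike.GradedMonoid 𝒜]

/-! Put z = xy. Every component of the ℤ-algebra is a free left k[z]-module of rank one, generated
by the power `mon` of x or y. This is made computable by a representation on k[X] in which an
element of degree d acts as p ↦ s · p(X + d); its symbol s determines it, and the symbol of yⁿ is
monic of degree n.

An automorphism of the ℤ-algebra sends the generator of one component to a nonzero scalar times the
generator of another (`exists_map_monElem`), because a unit of k[X] is constant. Let σ be its
permutation of ℤ. On a diagonal component it is an automorphism of k[X], so the image of z has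
degree 1; but z is the product of the generators with indices (i, i + 1) and (i + 1, i), whose image
has degree |σ(i + 1) - σ(i)|. So σ preserves adjacency (`abs_sub_eq_one`) and is i ↦ ±i + n, the
permutation of a power of α, preceded by ω̄ when the sign is negative.

If σ is the identity, then z and z - 1 both go to scalar multiples of themselves, which fixes k[z]
pointwise. The scalars on the generators then form a multiplicative cocycle on ℤ × ℤ, hence a
coboundary (`exists_eq_smul`), and rescaling the degree-i part of each module by the corresponding
scalar identifies the twist with the identity functor. So such automorphisms are inner; this gives
the generation statement and, after applying π, its image.

For the dihedral structure, ω² acts on degree d by (-1)^d, again a coboundary, and αω̄α = ω̄. No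
further relations hold: the graded module k[x] lives exactly in degrees ≥ 0, which a nontrivial
shift or any reflection of the grading fails to preserve. -/

theorem GrMod.smul_transport_smul_transport (M : GrMod 𝒜) {i j : ℤ} (h : i = j) {c d : k}
    (hcd : c * d = 1) (m : M.comp i) : c • M.transport h.symm (d • M.transport h m) = m := by
  rw [map_smul, smul_smul, hcd, one_smul, M.transport_transport, M.transport_rfl]

theorem GrMod.map_smul_transport {M N : GrMod 𝒜} (f : M ⟶ N) {i j : ℤ} (h : i = j) (c : k)
    (m : M.comp i) : c • N.transport h (f.app i m) = f.app j (c • M.transport h m) := by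
  rw [map_smul, GrMod.map_transport]

/-- Pullback functors along automorphisms that differ by a coboundary of scalars are isomorphic. -/
def pullIsoOfScalars (S T : CompAut 𝒜) (v : ℤ → kˣ) (hσ : ∀ i, S.σ i = T.σ i)
    (hφ : ∀ i j a, (S.φ i j a : R) = ((v i * (v j)⁻¹ : kˣ) : k) • (T.φ i j a : R)) :
    pull S ≅ pull T :=
  NatIso.ofComponents (fun M => GrMod.mkIso
    (M := (pull S).obj M) (N := (pull T).obj M)
    (fun i => (v i : k) • M.transport (hσ i))
    (fun i => ((v i)⁻¹ : kˣ).val • M.transport (hσ i).symm)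
    (fun i m => M.smul_transport_smul_transport (hσ i) (v i).inv_mul m)
    (fun i m => M.smul_transport_smul_transport (hσ i).symm (v i).mul_inv m)
    (fun i j m a => by
      change (v j : k) • M.transport (hσ j) (M.act (S.σ i) (S.σ j) m (S.φ i j a)) =
        M.act (T.σ i) (T.σ j) ((v i : k) • M.transport (hσ i) m) (T.φ i j a)
      rw [M.transport_act (hσ i) (hσ j) m (S.φ i j a)
        (((v i * (v j)⁻¹ : kˣ) : k) • T.φ i j a) (hφ i j a), map_smul, map_smul,
        LinearMap.smul_apply, smul_smul]
      congr 1
      rw [← Units.val_mul, mul_comm (v i), mul_inv_cancel_left]))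
    (fun {M _} f => GrMod.hom_ext fun i m =>
      GrMod.map_smul_transport f (hσ i) (v i : k) (show M.comp (S.σ i) from m))

/-- The class of an automorphism whose inverse is, up to a coboundary of scalars, given by the
components `T` is the class of the pullback functor of `T`. -/
theorem autToPic_eq_mk_pull [Nontrivial R] (γ : ZAut 𝒜) (T : CompAut 𝒜) (v : ℤ → kˣ)
    (h : ∀ i j a, (γ⁻¹ : ZAut 𝒜).1 (ZAlg.of 𝒜 i j a) =
      ((v i * (v j)⁻¹ : kˣ) : k) • ZAlg.of 𝒜 (T.σ i) (T.σ j) (T.φ i j a)) :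
    autToPic 𝒜 γ = Pic.mk k (pull T) := by
  have hγ := (γ⁻¹).2.2.choose_spec
  have hT : Permutes (γ⁻¹ : ZAut 𝒜).1 T.σ := fun i j a =>
    ⟨((v i * (v j)⁻¹ : kˣ) : k) • T.φ i j a, by rw [h, map_smul]⟩
  have e := permutes_unique hγ hT
  refine (Pic.mk_eq_iff k (GrMod 𝒜)).2 ⟨pullIsoOfScalars _ T v (fun i => congrArg (· i) e) ?_⟩
  intro i j a
  set S := compAut (γ⁻¹ : ZAut 𝒜).1 (γ⁻¹).2.1 _ hγ with hS
  have h1 : ZAlg.of 𝒜 (S.σ i) (S.σ j) (S.φ i j a) = (γ⁻¹ : ZAut 𝒜).1 (ZAlg.of 𝒜 i j a) :=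
    of_compAut _ _ _ hγ i j a
  have eσ : ∀ i, S.σ i = T.σ i := fun i => congrArg (· i) e
  have hm : (S.φ i j a : R) ∈ 𝒜 (T.σ j - T.σ i) := by
    rw [← eσ, ← eσ]
    exact (S.φ i j a).2
  rw [h, ZAlg.of_congr (eσ i) (eσ j) (S.φ i j a) ⟨_, hm⟩ rfl, ← map_smul] at h1
  exact congrArg Subtype.val (ZAlg.of_injective _ _ h1)

/-- The twist by γ is defined through γ⁻¹, so the class of an automorphism is computed by the
components `T` of its inverse. -/
theorem autToPic_toZAut [Nontrivial R] (S T : CompAut 𝒜) (hσ : ∀ i, S.σ (T.σ i) = i)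
    (hφ : ∀ i j (a : 𝒜 (j - i)), (S.φ _ _ (T.φ i j a) : R) = a) :
    autToPic 𝒜 S.toZAut = Pic.mk k (pull T) := by
  refine autToPic_eq_mk_pull _ T 1 fun i j a => ?_
  have : S.toZAut.1 (ZAlg.of 𝒜 (T.σ i) (T.σ j) (T.φ i j a)) = ZAlg.of 𝒜 i j a := by
    rw [CompAut.toZAut_of]
    exact ZAlg.of_congr (hσ i) (hσ j) _ _ (hφ i j a)
  rw [← this]
  simp only [Pi.one_apply, inv_one, mul_one, Units.val_one, one_smul]
  exact S.toZAut.1.symm_apply_apply _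

theorem autToPic_alpha [Nontrivial R] : autToPic 𝒜 (alpha 𝒜) = shiftPic 𝒜 :=
  autToPic_toZAut _ _ (fun i => by simp [shiftComp]) fun _ _ _ => rfl

theorem Permutes.mul {γ δ : ZAut 𝒜} {σ τ : Equiv.Perm ℤ} (hγ : Permutes γ.1 σ)
    (hδ : Permutes δ.1 τ) : Permutes (γ * δ).1 (σ * τ) := by
  intro i j a
  obtain ⟨b, hb⟩ := hδ i j a
  obtain ⟨c, hc⟩ := hγ _ _ b
  exact ⟨c, by rw [Subgroup.coe_mul, RingAut.mul_apply, hb, hc]; rfl⟩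

theorem Permutes.inv {γ : ZAut 𝒜} {σ : Equiv.Perm ℤ} (hγ : Permutes γ.1 σ) :
    Permutes (γ⁻¹).1 σ⁻¹ := permutes_inv hγ

theorem CompAut.permutes (T : CompAut 𝒜) : Permutes T.toZAut.1 T.σ :=
  fun i j a => ⟨_, T.toZAut_of i j a⟩

/-- Pulling back is contravariant, which is why the factors appear in reverse order. -/
theorem pic_mk_pull_mul (S T U : CompAut 𝒜) (hσ : ∀ i, S.σ (T.σ i) = U.σ i)
    (hφ : ∀ i j a, (S.φ _ _ (T.φ i j a) : R) = U.φ i j a) :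
    Pic.mk k (pull T) * Pic.mk k (pull S) = Pic.mk k (pull U) :=
  (Pic.mk_eq_iff k (GrMod 𝒜)).2 ⟨pullComp S T U hσ hφ⟩

variable (𝒜) in
theorem shiftPic_zpow (n : ℤ) : shiftPic 𝒜 ^ n = Pic.mk k (pull (shiftComp 𝒜 (-n))) := by
  -- Pulling back along translations is a homomorphism from ℤ, so it is determined by its value at
  -- 1, the shift.
  let f : Multiplicative ℤ →* Pic k (GrMod 𝒜) :=
    MonoidHom.mk' (fun n => Pic.mk k (pull (shiftComp 𝒜 (-n.toAdd)))) fun a b =>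
      (pic_mk_pull_mul _ _ _ (fun i => by simp [shiftComp]; ring) fun _ _ _ => rfl).symm
  have := map_zpow f (Multiplicative.ofAdd 1) n
  rw [← ofAdd_zsmul, smul_eq_mul, mul_one] at this
  exact this.symm

/-- The invariant that separates classes in the Picard group: which degrees of a test module are
nonzero. -/
theorem comp_equiv_of_pic_mk_eq {F G : GrMod 𝒜 ⥤ GrMod 𝒜} [F.IsEquivalence] [F.Additive]
    [F.Linear k] [G.IsEquivalence] [G.Additive] [G.Linear k] (h : Pic.mk k F = Pic.mk k G)
    (M : GrMod 𝒜) (i : ℤ) : Nonempty ((F.obj M).comp i ≃ (G.obj M).comp i) := by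
  obtain ⟨e⟩ := (Pic.mk_eq_iff k (GrMod 𝒜)).1 h
  refine ⟨⟨(e.hom.app M).app i, (e.inv.app M).app i, fun m => ?_, fun m => ?_⟩⟩
  · rw [← GrMod.comp_app, ← NatTrans.comp_app, e.hom_inv_id]; rfl
  · rw [← GrMod.comp_app, ← NatTrans.comp_app, e.inv_hom_id]; rfl

end Scalars

/-! ### Permutations of ℤ that preserve adjacency -/

section Integers

theorem perm_int_eq_add_or_neg_add (σ : Equiv.Perm ℤ) (h : ∀ i, |σ (i + 1) - σ i| = 1) :
    (∀ i, σ i = i + σ 0) ∨ ∀ i, σ i = -i + σ 0 := by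
  have step : ∀ i, σ (i + 1 + 1) - σ (i + 1) = σ (i + 1) - σ i := by
    intro i
    have h1 := h i
    have h2 := h (i + 1)
    -- Two consecutive increments of opposite sign would make σ return to an earlier value, so
    -- injectivity keeps the sign constant.
    have h3 : σ (i + 1 + 1) ≠ σ i := fun e => by have := σ.injective e; omega
    rcases abs_eq (zero_le_one' ℤ) |>.1 h1 with h1 | h1 <;>
      rcases abs_eq (zero_le_one' ℤ) |>.1 h2 with h2 | h2 <;> omega
  have const : ∀ i, σ (i + 1) - σ i = σ (0 + 1) - σ 0 := by
    intro i
    induction i using Int.induction_on with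
    | zero => rfl
    | succ n ih => rw [step, ih]
    | pred n ih =>
      have := step (-n - 1)
      rw [sub_add_cancel] at this ⊢
      rw [← this, ih]
  have lin : ∀ i, σ i = i * (σ (0 + 1) - σ 0) + σ 0 := by
    intro i
    induction i using Int.induction_on with
    | zero => simp
    | succ n ih => linarith [const n]
    | pred n ih =>
      have := const (-n - 1)
      rw [sub_add_cancel] at this
      linarith
  rcases abs_eq (zero_le_one' ℤ) |>.1 (h 0) with h0 | h0
  · left; intro i; rw [lin i, h0]; ring
  · right; intro i; rw [lin i, h0]; ring

end Integers

/-! ### A recognition criterion for the infinite dihedral group -/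

section Dihedral

/-- The homomorphism from the infinite dihedral group given by an element `t` and an involution `s`
that inverts `t`. -/
def dihedralLift {G : Type*} [Group G] (s t : G) (hs : s * s = 1) (hst : s * t * s⁻¹ = t⁻¹) :
    DihedralGroup 0 →* G where
  toFun
    | .r i => t ^ (show ℤ from i)
    | .sr i => s * t ^ (show ℤ from i)
  map_one' := zpow_zero t
  map_mul' := by
    -- Moving s to the left past a power of t inverts it; this yields the index differences in the
    -- dihedral multiplication table.
    have key : ∀ n : ℤ, t ^ n * s = s * t ^ (-n) := by
      intro n
      have h1 : s * t ^ (-n) * s⁻¹ = t ^ n := by rw [← conj_zpow, hst, inv_zpow', neg_neg]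
      rw [← h1, inv_mul_cancel_right]
    rintro (i | i) (j | j)
    · exact zpow_add t _ _
    · change s * t ^ (_ - _ : ℤ) = t ^ _ * (s * t ^ _)
      rw [← mul_assoc, key, mul_assoc, ← zpow_add]
      congr 2
      exact (neg_add_eq_sub _ _).symm
    · have h : ∀ m n : ℤ, s * t ^ (m + n) = s * t ^ m * t ^ n := fun m n => by
        rw [zpow_add, mul_assoc]
      exact h i j
    · change t ^ (_ - _ : ℤ) = s * t ^ _ * (s * t ^ _)
      rw [mul_assoc, ← mul_assoc _ s, key, mul_assoc s, ← mul_assoc s, hs, one_mul, ← zpow_add]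
      congr 1
      exact (neg_add_eq_sub _ _).symm

theorem nonempty_closure_mulEquiv_dihedralGroup {G : Type*} [Group G] (s t : G) (hs : s * s = 1)
    (hst : s * t * s⁻¹ = t⁻¹) (h1 : ∀ n : ℤ, t ^ n = 1 → n = 0) (h2 : ∀ n : ℤ, s * t ^ n ≠ 1) :
    Nonempty (Subgroup.closure {s, t} ≃* DihedralGroup 0) := by
  have hinj : Function.Injective (dihedralLift s t hs hst) := by
    rw [injective_iff_map_eq_one]
    rintro (i | i) h
    · exact congrArg DihedralGroup.r (h1 _ h)
    · exact (h2 _ h).elim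
  have hrange : (dihedralLift s t hs hst).range = Subgroup.closure {s, t} := by
    have hsm : s ∈ Subgroup.closure {s, t} := Subgroup.subset_closure (by simp)
    have htm : t ∈ Subgroup.closure {s, t} := Subgroup.subset_closure (by simp)
    apply le_antisymm
    · rintro _ ⟨i | i, rfl⟩
      · exact Subgroup.zpow_mem _ htm _
      · exact Subgroup.mul_mem _ hsm (Subgroup.zpow_mem _ htm _)
    · rw [Subgroup.closure_le]
      rintro g (hg | hg) <;> rw [hg]
      · exact ⟨.sr (0 : ℤ), by change s * t ^ (0 : ℤ) = s; simp⟩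
      · exact ⟨.r (1 : ℤ), zpow_one t⟩
  exact ⟨((MonoidHom.ofInjective hinj).trans (MulEquiv.subgroupCongr hrange)).symm⟩

end Dihedral

/-! ### Difference operators on k[X] and symbols -/

namespace Weyl

open Polynomial

variable {k : Type u} [Field k]

/-- The Weyl algebra acts on `k[X]` so that `x` shifts the variable by `1` and `x y` acts as
multiplication by `X`. -/
def polyRep : Weyl k →ₐ[k] Module.End k k[X] :=
  lift (fun b => if b then taylor 1 else LinearMap.mulLeft k (X - 1) ∘ₗ taylor (-1)) (by
    ext1 n
    apply LinearMap.ext_ring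
    simp only [if_true, Bool.false_eq_true, if_false, LinearMap.comp_apply, LinearMap.sub_apply,
      Module.End.mul_apply, LinearMap.mulLeft_apply, taylor_mul, taylor_taylor, add_neg_cancel,
      neg_add_cancel, taylor_zero, map_sub, taylor_X, taylor_one, map_one, Module.End.one_apply]
    ring)

@[simp] theorem polyRep_x (p : k[X]) : polyRep (x k) p = taylor 1 p := by simp [polyRep, x]

@[simp] theorem polyRep_y (p : k[X]) : polyRep (y k) p = (X - 1) * taylor (-1) p := by
  simp [polyRep, y]

/-- The symbol of an element of the Weyl algebra: the polynomial that it maps `1` to. -/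
def symbol : Weyl k →ₗ[k] k[X] := LinearMap.applyₗ 1 ∘ₗ polyRep.toLinearMap

theorem symbol_apply (a : Weyl k) : symbol a = polyRep a 1 := rfl

@[simp] theorem symbol_one : symbol (1 : Weyl k) = 1 := by simp [symbol_apply]

/-- Each letter acts as a multiplication after a translation by its degree. Such operators compose
with their translations adding up, so the degree fixes the translation and only the symbol remains
as data. -/
theorem polyRep_of_mem {d : ℤ} {a : Weyl k} (ha : a ∈ grading k d) (p : k[X]) :
    polyRep a p = symbol a * taylor (d : k) p := by
  induction ha using Submodule.span_induction with
  | mem a h =>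
    obtain ⟨w, rfl, rfl⟩ := h
    induction w with
    | nil => simp
    | cons b w ih =>
      rw [symbol_apply] at ih ⊢
      cases b
      · have e : ((deg false + (w.map deg).sum : ℤ) : k) = -1 + ((w.map deg).sum : ℤ) := by
          simp [deg]
        simp only [List.map_cons, List.prod_cons, List.sum_cons, map_mul, Module.End.mul_apply, ih]
        change polyRep (y k) _ = polyRep (y k) _ * _
        rw [polyRep_y, polyRep_y, taylor_mul, taylor_taylor, e]
        exact (mul_assoc _ _ _).symm
      · have e : ((deg true + (w.map deg).sum : ℤ) : k) = 1 + ((w.map deg).sum : ℤ) := by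
          simp [deg]
        simp only [List.map_cons, List.prod_cons, List.sum_cons, map_mul, Module.End.mul_apply, ih]
        change polyRep (x k) _ = polyRep (x k) _ * _
        rw [polyRep_x, polyRep_x, taylor_mul, taylor_taylor, e]
  | zero => simp
  | add a b ha hb iha ihb => simp [iha, ihb, add_mul]
  | smul c a ha iha => simp [iha]

theorem symbol_mul {d : ℤ} {a : Weyl k} (ha : a ∈ grading k d) (b : Weyl k) :
    symbol (a * b) = symbol a * taylor (d : k) (symbol b) := by
  rw [← polyRep_of_mem ha, symbol_apply, map_mul, Module.End.mul_apply, symbol_apply]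

instance : Nontrivial (Weyl k) :=
  ⟨1, 0, fun h => one_ne_zero (α := k[X]) (by rw [← symbol_one, h, map_zero])⟩

/-! ### The graded components as free rank-one modules over k[xy] -/

variable (k) in
/-- The element `x y`. -/
def z : Weyl k := x k * y k

theorem y_mul_x : y k * x k = z k - 1 := by
  rw [z, ← rel k]
  change _ = x k * y k - (x k * y k - y k * x k)
  abel

theorem z_mem : z k ∈ grading k 0 := by
  simpa [z] using SetLike.GradedMul.mul_mem (A := grading k) x_mem y_mem

theorem aeval_z_mem (f : k[X]) : aeval (z k) f ∈ grading k 0 := by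
  induction f using Polynomial.induction_on' with
  | add f g hf hg => rw [map_add]; exact add_mem hf hg
  | monomial n c =>
    rw [aeval_monomial, ← Algebra.smul_def]
    exact Submodule.smul_mem _ _ (by simpa using SetLike.pow_mem_graded n (z_mem (k := k)))

@[simp] theorem symbol_aeval_z (f : k[X]) : symbol (aeval (z k) f) = f := by
  have key : ∀ n : ℕ, symbol (z k ^ n) = X ^ n := by
    intro n
    induction n with
    | zero => simp
    | succ n ih =>
      rw [pow_succ', symbol_mul z_mem, ih, z, symbol_apply, map_mul, Module.End.mul_apply,
        polyRep_x, polyRep_y, Int.cast_zero, taylor_zero, taylor_mul, map_sub, taylor_X,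
        pow_succ']
      simp
  induction f using Polynomial.induction_on' with
  | add f g hf hg => rw [map_add, map_add, hf, hg]
  | monomial n c =>
    rw [aeval_monomial, ← Algebra.smul_def, map_smul, key, ← C_mul_X_pow_eq_monomial,
      smul_eq_C_mul]

/-- Common source of the commutation rules x f(z) = f(z + 1) x and y f(z) = f(z - 1) y, which move
coefficients to the left. -/
theorem mul_aeval_z {a : Weyl k} {c : k} (h : a * z k = (z k + algebraMap k _ c) * a) (f : k[X]) :
    a * aeval (z k) f = aeval (z k) (taylor c f) * a := by
  have hs : SemiconjBy a (z k) (z k + algebraMap k _ c) := h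
  rw [taylor_apply, aeval_comp, map_add, aeval_X, aeval_C]
  induction f using Polynomial.induction_on' with
  | add f g hf hg => rw [map_add, map_add, mul_add, add_mul, hf, hg]
  | monomial n c =>
    rw [aeval_monomial, aeval_monomial, ← mul_assoc, ← Algebra.commutes, mul_assoc,
      (hs.pow_right n).eq, mul_assoc]

theorem x_mul_aeval_z (f : k[X]) : x k * aeval (z k) f = aeval (z k) (taylor 1 f) * x k := by
  refine mul_aeval_z ?_ f
  have h : x k * y k = y k * x k + 1 := by rw [y_mul_x, sub_add_cancel, z]
  nth_rw 1 [z]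
  rw [h, mul_add, ← mul_assoc, ← z, mul_one, map_one, add_mul, one_mul]

theorem y_mul_aeval_z (f : k[X]) : y k * aeval (z k) f = aeval (z k) (taylor (-1) f) * y k := by
  refine mul_aeval_z ?_ f
  nth_rw 1 [z]
  rw [← mul_assoc, y_mul_x, map_neg, map_one, sub_eq_add_neg]

variable (k) in
/-- The generator of the component of degree `d` over `k[xy]`: a power of `x` or of `y`. -/
def mon (d : ℤ) : Weyl k := if 0 ≤ d then x k ^ d.toNat else y k ^ (-d).toNat

theorem mon_natCast (n : ℕ) : mon k n = x k ^ n := by simp [mon]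

theorem mon_neg_natCast (n : ℕ) : mon k (-n) = y k ^ n := by
  rcases n with _ | n
  · simp [mon]
  · rw [mon, if_neg (by omega)]; simp

@[simp] theorem mon_zero : mon k 0 = 1 := by simp [mon]

theorem mon_mem (d : ℤ) : mon k d ∈ grading k d := by
  obtain ⟨n, rfl | rfl⟩ := d.eq_nat_or_neg
  · rw [mon_natCast]
    simpa using SetLike.pow_mem_graded (A := grading k) n x_mem
  · rw [mon_neg_natCast]
    simpa using SetLike.pow_mem_graded (A := grading k) n y_mem

/-- A letter either lengthens the power, with coefficient 1, or cancels against it: xy contributes z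
and yx contributes z - 1. -/
theorem exists_gen_mul_mon (b : Bool) (d : ℤ) :
    ∃ f : k[X], gen k b * mon k d = aeval (z k) f * mon k (deg b + d) := by
  obtain ⟨n, rfl | rfl⟩ := d.eq_nat_or_neg <;> cases b
  · change ∃ f, y k * _ = _
    rcases n with _ | n
    · exact ⟨1, by simpa [deg] using (mon_neg_natCast (k := k) 1).symm⟩
    · refine ⟨X - 1, ?_⟩
      have e : deg false + ((n + 1 : ℕ) : ℤ) = n := by simp [deg]
      rw [e, mon_natCast, mon_natCast, pow_succ', ← mul_assoc, y_mul_x]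
      simp
  · refine ⟨1, ?_⟩
    have e : deg true + (n : ℤ) = (n + 1 : ℕ) := by simp [deg, add_comm]
    rw [e, mon_natCast, mon_natCast, pow_succ', map_one, one_mul]
    rfl
  · refine ⟨1, ?_⟩
    have e : deg false + -(n : ℤ) = -(n + 1 : ℕ) := by simp [deg]
    rw [e, mon_neg_natCast, mon_neg_natCast, pow_succ', map_one, one_mul]
    rfl
  · change ∃ f, x k * _ = _
    rcases n with _ | n
    · exact ⟨1, by simpa [deg] using (mon_natCast (k := k) 1).symm⟩
    · refine ⟨X, ?_⟩
      have e : deg true + -((n + 1 : ℕ) : ℤ) = -n := by simp [deg]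
      rw [e, mon_neg_natCast, mon_neg_natCast, pow_succ', ← mul_assoc, aeval_X, z]

theorem exists_eq_aeval_mul_mon {d : ℤ} {a : Weyl k} (ha : a ∈ grading k d) :
    ∃ f : k[X], a = aeval (z k) f * mon k d := by
  induction ha using Submodule.span_induction with
  | mem a h =>
    obtain ⟨w, rfl, rfl⟩ := h
    induction w with
    | nil => exact ⟨1, by simp [mon]⟩
    | cons b w ih =>
      obtain ⟨f, hf⟩ := ih
      obtain ⟨g, hg⟩ := exists_gen_mul_mon (k := k) b (w.map deg).sum
      have hb : ∃ f' : k[X], gen k b * aeval (z k) f = aeval (z k) f' * gen k b := by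
        cases b
        · exact ⟨_, y_mul_aeval_z f⟩
        · exact ⟨_, x_mul_aeval_z f⟩
      obtain ⟨f', hf'⟩ := hb
      refine ⟨f' * g, ?_⟩
      rw [List.map_cons, List.prod_cons, hf, ← mul_assoc, hf', mul_assoc, hg, ← mul_assoc,
        ← map_mul, List.map_cons, List.sum_cons]
  | zero => exact ⟨0, by simp⟩
  | add a b ha hb iha ihb =>
    obtain ⟨f, hf⟩ := iha
    obtain ⟨g, hg⟩ := ihb
    exact ⟨f + g, by rw [hf, hg, map_add, add_mul]⟩
  | smul c a ha iha =>
    obtain ⟨f, hf⟩ := iha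
    exact ⟨c • f, by rw [hf, map_smul, smul_mul_assoc]⟩

theorem symbol_aeval_z_mul (f : k[X]) (b : Weyl k) :
    symbol (aeval (z k) f * b) = f * symbol b := by
  rw [symbol_mul (aeval_z_mem (k := k) f), symbol_aeval_z, Int.cast_zero, taylor_zero]

theorem symbol_mon_natCast (n : ℕ) : symbol (mon k n) = 1 := by
  rw [mon_natCast]
  induction n with
  | zero => simp
  | succ n ih => rw [pow_succ', symbol_mul x_mem, ih]; simp [symbol_apply]

theorem symbol_y_pow_succ (n : ℕ) :
    symbol (y k ^ (n + 1)) = (X - 1) * taylor (-1) (symbol (y k ^ n)) := by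
  rw [pow_succ', symbol_mul y_mem]; simp [symbol_apply]

/-- By the recursion for powers of y, the symbol of yⁿ is (X - 1)(X - 2)⋯(X - n), while that of xⁿ
is 1. -/
theorem symbol_mon_monic (d : ℤ) :
    (symbol (mon k d)).Monic ∧ (symbol (mon k d)).natDegree = (-d).toNat := by
  obtain ⟨n, rfl | rfl⟩ := d.eq_nat_or_neg
  · rw [symbol_mon_natCast]; simp
  · rw [mon_neg_natCast, neg_neg, Int.toNat_natCast]
    induction n with
    | zero => simp
    | succ n ih =>
      have h1 : (X - 1 : k[X]).Monic := by simpa using monic_X_sub_C (1 : k)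
      have h2 : (X - 1 : k[X]).natDegree = 1 := by simpa using natDegree_X_sub_C (1 : k)
      have h3 : (taylor (-1) (symbol (y k ^ n))).Monic := by
        rw [Monic, leadingCoeff_taylor]; exact ih.1
      rw [symbol_y_pow_succ]
      exact ⟨h1.mul h3, by rw [h1.natDegree_mul h3, h2, natDegree_taylor, ih.2, add_comm]⟩

theorem symbol_mon_ne_zero (d : ℤ) : symbol (mon k d) ≠ 0 := (symbol_mon_monic d).1.ne_zero

/-- The symbol of an element of degree `-n` vanishes at `1, …, n`. -/
theorem symbol_eval_eq_zero {d : ℤ} {a : Weyl k} (ha : a ∈ grading k d) {i : ℤ} (hi : 0 ≤ i)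
    (hid : i + d < 0) : (symbol a).eval (i + 1 : k) = 0 := by
  obtain ⟨f, rfl⟩ := exists_eq_aeval_mul_mon ha
  obtain ⟨n, rfl⟩ := Int.eq_ofNat_of_zero_le hi
  obtain ⟨l, rfl⟩ : ∃ l : ℕ, d = -l := ⟨(-d).toNat, by omega⟩
  rw [symbol_aeval_z_mul, eval_mul, mon_neg_natCast]
  clear ha hi
  suffices h : (symbol (y k ^ l)).eval ((n : k) + 1) = 0 by
    rw [Int.cast_natCast, h, mul_zero]
  induction n generalizing l with
  | zero =>
    obtain ⟨l, rfl⟩ : ∃ m, l = m + 1 := ⟨l - 1, by omega⟩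
    rw [symbol_y_pow_succ]; simp
  | succ n ih =>
    obtain ⟨l, rfl⟩ : ∃ m, l = m + 1 := ⟨l - 1, by omega⟩
    have e : ((n + 1 : ℕ) : k) + 1 + -1 = n + 1 := by push_cast; ring
    rw [symbol_y_pow_succ, eval_mul, taylor_eval, e, ih l (by push_cast at hid ⊢; omega), mul_zero]

theorem symbol_injOn {d : ℤ} {a b : Weyl k} (ha : a ∈ grading k d) (hb : b ∈ grading k d)
    (h : symbol a = symbol b) : a = b := by
  obtain ⟨f, rfl⟩ := exists_eq_aeval_mul_mon ha
  obtain ⟨g, rfl⟩ := exists_eq_aeval_mul_mon hb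
  rw [symbol_aeval_z_mul, symbol_aeval_z_mul] at h
  rw [mul_right_cancel₀ (symbol_mon_ne_zero d) h]

end Weyl

/-! ### The action of an automorphism on generators and diagonal components -/

namespace Weyl

open Polynomial

variable {k : Type u} [Field k]

/-- The homogeneous element `f(x y)` as an element of the component with index `(i, i)`. -/
def diagElem (i : ℤ) (f : k[X]) : grading k (i - i) :=
  ⟨aeval (z k) f, by rw [sub_self]; exact aeval_z_mem f⟩

/-- The generator of the component with index `(i, j)`. -/
def monElem (i j : ℤ) : grading k (j - i) := ⟨mon k (j - i), mon_mem _⟩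

@[simp] theorem coe_diagElem (i : ℤ) (f : k[X]) : (diagElem i f : Weyl k) = aeval (z k) f := rfl

@[simp] theorem coe_monElem (i j : ℤ) : ((monElem i j : grading k (j - i)) : Weyl k) = mon k (j - i) := rfl

@[simp] theorem symbol_z : symbol (z k) = X := by simpa using symbol_aeval_z (k := k) X

theorem exists_eq_compMul (i j : ℤ) (a : grading k (j - i)) :
    ∃ f : k[X], a = ZAlg.compMul (diagElem i f) (monElem i j) := by
  obtain ⟨f, hf⟩ := exists_eq_aeval_mul_mon a.2
  exact ⟨f, Subtype.ext hf⟩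

theorem symbol_mul_diag {i : ℤ} (a : grading k (i - i)) (b : Weyl k) :
    symbol ((a : Weyl k) * b) = symbol (a : Weyl k) * symbol b := by
  have h : ((i - i : ℤ) : k) = 0 := by simp
  rw [symbol_mul a.2, h, taylor_zero]

theorem compMul_monElem_succ (i : ℤ) :
    ZAlg.compMul (monElem i (i + 1)) (monElem (i + 1) i) = diagElem (k := k) i X := by
  apply Subtype.ext
  have h1 : mon k 1 = x k := by simpa using mon_natCast (k := k) 1
  have h2 : mon k (-1) = y k := by simpa using mon_neg_natCast (k := k) 1
  simp [h1, h2, z]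

/-- Going around through i - 1 gives yx = z - 1, while going through i + 1 gives xy = z. Having both
is what rigidifies automorphisms with trivial permutation. -/
theorem compMul_monElem_pred (i : ℤ) :
    ZAlg.compMul (monElem i (i - 1)) (monElem (i - 1) i) = diagElem (k := k) i (X - 1) := by
  apply Subtype.ext
  have h1 : mon k 1 = x k := by simpa using mon_natCast (k := k) 1
  have h2 : mon k (-1) = y k := by simpa using mon_neg_natCast (k := k) 1
  simp [h1, h2, y_mul_x]

theorem exists_map_monElem (T : CompAut (grading k)) (i j : ℤ) :
    ∃ c : kˣ, T.φ i j (monElem i j) = (c : k) • monElem (T.σ i) (T.σ j) := by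
  obtain ⟨f, hf⟩ := exists_eq_compMul _ _ (T.φ i j (monElem i j))
  obtain ⟨g, hg⟩ := exists_eq_compMul _ _ ((T.φ i j).symm (monElem (T.σ i) (T.σ j)))
  rw [LinearEquiv.symm_apply_eq, T.φ_mul, hf] at hg
  have h := congrArg (fun a : grading k _ => symbol (a : Weyl k)) hg
  simp only [ZAlg.coe_compMul, symbol_mul_diag, coe_diagElem, symbol_aeval_z_mul] at h
  rw [← mul_assoc] at h
  -- Cancelling the symbol of the target generator shows that the coefficient `f` divides 1 in k[X],
  -- so it is a nonzero constant.
  have h1 := mul_right_cancel₀ (symbol_mon_ne_zero _) ((one_mul _).trans h)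
  obtain ⟨c, hc, rfl⟩ := Polynomial.isUnit_iff.1
    (IsUnit.of_mul_eq_one _ ((mul_comm _ _).trans h1.symm))
  refine ⟨hc.unit, hf.trans (Subtype.ext ?_)⟩
  simp [Algebra.smul_def]

/-- The action of an automorphism of the `ℤ`-algebra on the component with index `(i, i)`,
identified with `k[X]`. -/
def diagHom (T : CompAut (grading k)) (i : ℤ) : k[X] →ₐ[k] k[X] :=
  AlgHom.ofLinearMap
    { toFun := fun f => symbol (T.φ i i (diagElem i f) : Weyl k)
      map_add' := fun f g => by
        rw [show diagElem i (f + g) = diagElem i f + diagElem i g from Subtype.ext (map_add _ _ _)]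
        simp
      map_smul' := fun c f => by
        rw [show diagElem i (c • f) = c • diagElem i f from Subtype.ext (map_smul _ _ _)]
        simp }
    (by
      change symbol (T.φ i i (diagElem i 1) : Weyl k) = 1
      rw [show diagElem i 1 = ZAlg.unit (𝒜 := grading k) i from Subtype.ext (map_one _), T.φ_one]
      simp)
    (fun f g => by
      change symbol (T.φ i i (diagElem i (f * g)) : Weyl k) = _
      rw [show diagElem i (f * g) = ZAlg.compMul (diagElem i f) (diagElem i g) from
        Subtype.ext (map_mul _ _ _), T.φ_mul, ZAlg.coe_compMul, symbol_mul_diag]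
      rfl)

theorem diagHom_apply (T : CompAut (grading k)) (i : ℤ) (f : k[X]) :
    diagHom T i f = symbol (T.φ i i (diagElem i f) : Weyl k) := rfl

theorem diagHom_eq_comp (T : CompAut (grading k)) (i : ℤ) (f : k[X]) :
    diagHom T i f = f.comp (diagHom T i X) := by
  rw [comp_eq_aeval, aeval_algHom_apply, aeval_X_left_apply]

/-- Endomorphisms of k[X] are substitutions. By surjectivity some polynomial composed with the image
of X gives X, and degrees multiply under composition. -/
theorem natDegree_diagHom_X (T : CompAut (grading k)) (i : ℤ) :
    (diagHom T i X).natDegree = 1 := by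
  obtain ⟨g, hg⟩ := exists_eq_compMul _ _ ((T.φ i i).symm (diagElem (T.σ i) X))
  have h1 : ZAlg.compMul (diagElem i g) (monElem i i) = diagElem i g := Subtype.ext (by simp)
  rw [h1, LinearEquiv.symm_apply_eq] at hg
  have h2 : diagHom T i g = X := by rw [diagHom_apply, ← hg]; simp
  have h3 := congrArg natDegree h2
  rw [diagHom_eq_comp, natDegree_comp, natDegree_X] at h3
  exact Nat.eq_one_of_mul_eq_one_left h3

/-- Compute the degree of the image of z twice: it is 1, and it is also the degree of the product of
the generators of degrees d and -d, namely |d|. -/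
theorem abs_sub_eq_one (T : CompAut (grading k)) (i : ℤ) : |T.σ (i + 1) - T.σ i| = 1 := by
  have h := natDegree_diagHom_X T i
  obtain ⟨c, hc⟩ := exists_map_monElem T i (i + 1)
  obtain ⟨c', hc'⟩ := exists_map_monElem T (i + 1) i
  rw [diagHom_apply, ← compMul_monElem_succ, T.φ_mul, hc, hc'] at h
  set d := T.σ (i + 1) - T.σ i with hd
  have hd' : T.σ i - T.σ (i + 1) = -d := by ring
  simp only [ZAlg.coe_compMul, Submodule.coe_smul, coe_monElem, smul_mul_smul_comm, map_smul,
    symbol_mul (mon_mem d), ← hd, hd'] at h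
  rw [natDegree_smul _ (mul_ne_zero c.ne_zero c'.ne_zero),
    natDegree_mul (symbol_mon_ne_zero _) ((taylor_eq_zero _ _).not.2 (symbol_mon_ne_zero _)),
    natDegree_taylor, (symbol_mon_monic _).2, (symbol_mon_monic _).2] at h
  rw [Int.abs_eq_natAbs]
  omega

theorem diagHom_eq_id (T : CompAut (grading k)) (hσ : T.σ = 1) (i : ℤ) (f : k[X]) :
    diagHom T i f = f := by
  have key : ∀ (j : ℤ) (g : k[X]),
      ZAlg.compMul (monElem i j) (monElem j i) = diagElem (k := k) i g →
      ∃ c : k, diagHom T i g = C c * g := by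
    intro j g hg
    obtain ⟨c, hc⟩ := exists_map_monElem T i j
    obtain ⟨c', hc'⟩ := exists_map_monElem T j i
    refine ⟨c * c', ?_⟩
    have hg' := congrArg (fun a : grading k _ => symbol (a : Weyl k)) hg
    rw [diagHom_apply, ← hg, T.φ_mul, hc, hc']
    simp only [ZAlg.coe_compMul, Submodule.coe_smul, coe_monElem, smul_mul_smul_comm, map_smul, hσ,
      Equiv.Perm.one_apply, smul_eq_C_mul, coe_diagElem, symbol_aeval_z] at hg' ⊢
    rw [hg']
  obtain ⟨a, ha⟩ := key _ _ (compMul_monElem_succ i)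
  obtain ⟨b, hb⟩ := key _ _ (compMul_monElem_pred i)
  -- The relation is aX - 1 = b(X - 1); comparing coefficients forces a = b = 1.
  rw [map_sub, map_one, ha] at hb
  have h0 := congrArg (coeff · 0) hb
  have h1 := congrArg (coeff · 1) hb
  simp [mul_sub, coeff_one, coeff_X, coeff_C] at h0 h1
  rw [diagHom_eq_comp, ha, h1, ← h0]
  simp

theorem exists_eq_smul (T : CompAut (grading k)) (hσ : T.σ = 1) :
    ∃ v : ℤ → kˣ, ∀ i j a, (T.φ i j a : Weyl k) = ((v i * (v j)⁻¹ : kˣ) : k) • (a : Weyl k) := by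
  choose c hc using exists_map_monElem T
  have hφ : ∀ i j a, (T.φ i j a : Weyl k) = (c i j : k) • (a : Weyl k) := by
    intro i j a
    obtain ⟨f, rfl⟩ := exists_eq_compMul _ _ a
    have h1 : (T.φ i i (diagElem i f) : Weyl k) = aeval (z k) f := by
      refine symbol_injOn (T.φ i i (diagElem i f)).2 (by simpa using aeval_z_mem f) ?_
      rw [← diagHom_apply, diagHom_eq_id T hσ, symbol_aeval_z]
    rw [T.φ_mul, ZAlg.coe_compMul, h1, hc]
    simp [hσ]
  -- The cocycle identity can be read off because a product of two generators is nonzero.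
  have hmul : ∀ i j l, c i j * c j l = c i l := by
    intro i j l
    have h := congrArg Subtype.val (T.φ_mul i j l (monElem i j) (monElem j l))
    rw [ZAlg.coe_compMul, hφ, hφ, hφ, smul_mul_smul_comm, ZAlg.coe_compMul] at h
    have h0 : ((monElem i j : grading k (j - i)) : Weyl k) * (monElem j l : grading k (l - j)) ≠ 0 := by
      intro h0
      have := congrArg symbol h0
      rw [coe_monElem, coe_monElem, symbol_mul (mon_mem _), map_zero] at this
      exact mul_ne_zero (symbol_mon_ne_zero _)
        ((taylor_eq_zero _ _).not.2 (symbol_mon_ne_zero _)) this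
    exact Units.ext (smul_left_injective k h0 h).symm
  -- A cocycle on all pairs of integers is trivialised by its values from the base point 0.
  refine ⟨fun i => (c 0 i)⁻¹, fun i j a => ?_⟩
  simp only
  rw [hφ, inv_inv, ← hmul 0 i j, inv_mul_cancel_left]

end Weyl

/-! ### A sufficient condition for an automorphism to be inner -/

section Kernel

variable {k R : Type u} [CommRing k] [Ring R] [Algebra k R] {𝒜 : ℤ → Submodule k R}
  [SetLike.GradedMonoid 𝒜]

theorem mem_ker_of_scalars [Nontrivial R] (γ : ZAut 𝒜) (v : ℤ → kˣ)
    (h : ∀ i j a, γ.1 (ZAlg.of 𝒜 i j a) = ((v i * (v j)⁻¹ : kˣ) : k) • ZAlg.of 𝒜 i j a) :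
    γ ∈ (autToPic 𝒜).ker := by
  -- Passing to γ⁻¹ makes the inverse in the class formula the given γ.
  rw [← inv_mem_iff, MonoidHom.mem_ker, autToPic_eq_mk_pull γ⁻¹ (shiftComp 𝒜 0) v]
  · exact (Pic.mk_eq_iff k (GrMod 𝒜)).2 ⟨pullId 𝒜⟩
  · intro i j a
    rw [inv_inv, h]
    congr 1
    exact ZAlg.of_congr (add_zero i).symm (add_zero j).symm _ _ rfl

theorem ZAut.ext_of {γ δ : ZAut 𝒜}
    (h : ∀ i j a, γ.1 (ZAlg.of 𝒜 i j a) = δ.1 (ZAlg.of 𝒜 i j a)) : γ = δ := by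
  refine Subtype.ext (RingEquiv.ext fun x => ?_)
  induction x using ZAlg.induction with
  | h0 => rw [map_zero, map_zero]
  | hof i j a => exact h i j a
  | hadd x y hx hy => rw [map_add, map_add, hx, hy]

end Kernel

/-! ### Relations between α and ω̄, and generation of the automorphism group -/

namespace Weyl

variable {k : Type u} [Field k]

theorem omegaBar_of (i j : ℤ) (a : grading k (j - i)) :
    (omegaBar k).1 (ZAlg.of (grading k) i j a) = ZAlg.of (grading k) (-i) (-j) ⟨omega a, by
      simpa [add_comm, sub_eq_add_neg] using omega_mem _ _ a.2⟩ :=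
  CompAut.toZAut_of _ _ _ _

theorem alpha_of (i j : ℤ) (a : grading k (j - i)) :
    (alpha (grading k)).1 (ZAlg.of (grading k) i j a) =
      ZAlg.of (grading k) (i + 1) (j + 1) ⟨a, by simp⟩ :=
  CompAut.toZAut_of _ _ _ _

theorem autToPic_omegaBar : autToPic (grading k) (omegaBar k) = omegaPic k :=
  autToPic_toZAut _ _ (fun i => neg_neg i) fun _ _ _ => omega.apply_symm_apply _

/-- ω² negates both letters, and the length of a word has the parity of its degree. -/
theorem omega_omega {d : ℤ} {a : Weyl k} (ha : a ∈ grading k d) :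
    omega (omega a) = (-1 : k) ^ d • a := by
  induction ha using Submodule.span_induction with
  | mem a h =>
    obtain ⟨w, rfl, rfl⟩ := h
    induction w with
    | nil => simp
    | cons b w ih =>
      have hb : omega (omega (gen k b)) = -gen k b := by
        cases b
        · change omega (omega (y k)) = -y k; simp
        · change omega (omega (x k)) = -x k; simp
      have hd : (-1 : k) ^ deg b = -1 := by cases b <;> simp [deg]
      simp only [List.map_cons, List.prod_cons, List.sum_cons, map_mul, ih, hb]
      rw [zpow_add₀ (by simp), hd]
      simp
  | zero => simp
  | add a b ha hb iha ihb => simp [iha, ihb]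
  | smul c a ha iha => simp [iha, smul_comm c]

theorem omegaBar_mul_self_mem_ker : omegaBar k * omegaBar k ∈ (autToPic (grading k)).ker := by
  refine mem_ker_of_scalars _ (fun i => (-1) ^ (-i)) fun i j a => ?_
  have e : (((-1) ^ (-i) * ((-1) ^ (-j))⁻¹ : kˣ) : k) = (-1) ^ (j - i) := by
    rw [← zpow_neg, ← zpow_add, neg_neg, neg_add_eq_sub]
    simp
  rw [e, Subgroup.coe_mul, RingAut.mul_apply, omegaBar_of, omegaBar_of, ← map_smul]
  exact ZAlg.of_congr (neg_neg i) (neg_neg j) _ _ (omega_omega a.2)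

theorem alpha_mul_omegaBar_mul_alpha :
    alpha (grading k) * omegaBar k * alpha (grading k) = omegaBar k := by
  refine ZAut.ext_of fun i j a => ?_
  rw [Subgroup.coe_mul, Subgroup.coe_mul, RingAut.mul_apply, RingAut.mul_apply, alpha_of,
    omegaBar_of, alpha_of, omegaBar_of]
  exact ZAlg.of_congr (by ring) (by ring) _ _ rfl

theorem m_eq (i j : ℤ) : m k i j = ZAlg.of (grading k) i j (monElem i j) := by
  refine congrArg _ (Subtype.ext ?_)
  simp [mon]

theorem omegaBar_m (i j : ℤ) (h : i ≤ j) : (omegaBar k).1 (m k i j) = m k (-i) (-j) := by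
  obtain ⟨n, rfl⟩ := Int.le.dest h
  rw [m_eq, m_eq, omegaBar_of]
  refine congrArg _ (Subtype.ext ?_)
  have e : -(i + (n : ℤ)) - -i = -n := by ring
  simp only [coe_monElem, add_sub_cancel_left, e, mon_natCast, mon_neg_natCast, map_pow, omega_x]

theorem omegaBar_m_of_lt (i j : ℤ) (h : j < i) :
    (omegaBar k).1 (m k i j) = (-1 : k) ^ (i - j) • m k (-i) (-j) := by
  obtain ⟨n, rfl⟩ := Int.le.dest h.le
  rw [m_eq, m_eq, omegaBar_of, ← map_smul]
  refine congrArg _ (Subtype.ext ?_)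
  have e : j - (j + (n : ℤ)) = -n := by ring
  have e' : -j - -(j + (n : ℤ)) = n := by ring
  simp only [coe_monElem, add_sub_cancel_left, e, e', mon_natCast, mon_neg_natCast, map_pow,
    omega_y, Submodule.coe_smul, zpow_natCast]
  rw [neg_pow (x k), Algebra.smul_def, map_pow, map_neg, map_one]

/-- This reduces the generation statement to permutations: two automorphisms with the same
permutation differ by an inner one. -/
theorem mem_ker_of_permutes_one {γ : ZAut (grading k)} (h : Permutes γ.1 1) :
    γ ∈ (autToPic (grading k)).ker := by
  obtain ⟨v, hv⟩ := exists_eq_smul (compAut γ.1 γ.2.1 1 h) rfl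
  refine mem_ker_of_scalars γ v fun i j a => ?_
  rw [← of_compAut γ.1 γ.2.1 1 h, ← map_smul]
  exact congrArg _ (Subtype.ext (hv i j a))

theorem closure_ker_union_eq_top :
    Subgroup.closure (((autToPic (grading k)).ker : Set (ZAut (grading k))) ∪
      {alpha (grading k), omegaBar k}) = ⊤ := by
  set G := Subgroup.closure (((autToPic (grading k)).ker : Set (ZAut (grading k))) ∪
      {alpha (grading k), omegaBar k}) with hG
  have hα : alpha (grading k) ∈ G := Subgroup.subset_closure (by simp)
  have hω : omegaBar k ∈ G := Subgroup.subset_closure (by simp)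
  have shift : ∀ n : ℤ, ∃ g ∈ G, Permutes g.1 (Equiv.addRight n) := by
    have hp : Permutes (alpha (grading k)).1 (Equiv.addRight 1) := CompAut.permutes _
    intro n
    induction n using Int.induction_on with
    | zero => exact ⟨1, one_mem _, fun i j a => ⟨⟨a, by simp⟩,
        ZAlg.of_congr (add_zero i).symm (add_zero j).symm _ _ rfl⟩⟩
    | succ n ih =>
      obtain ⟨g, hg, h⟩ := ih
      refine ⟨_, mul_mem hα hg, ?_⟩
      convert hp.mul h using 1
      ext i
      simp [add_assoc]
    | pred n ih =>
      obtain ⟨g, hg, h⟩ := ih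
      refine ⟨_, mul_mem (inv_mem hα) hg, ?_⟩
      convert hp.inv.mul h using 1
      ext i
      rw [Equiv.Perm.mul_apply, eq_comm, Equiv.Perm.inv_eq_iff_eq]
      simp only [Equiv.coe_addRight]
      ring
  refine (Subgroup.eq_top_iff' G).2 fun γ => ?_
  obtain ⟨σ, hσ⟩ := γ.2.2
  have : ∃ g ∈ G, Permutes g.1 σ := by
    obtain ⟨g, hg, h⟩ := shift (σ 0)
    -- A translation is realised by `g` itself, a reflection by applying ω̄ first and then `g`.
    rcases perm_int_eq_add_or_neg_add σ (abs_sub_eq_one (compAut γ.1 γ.2.1 σ hσ)) with h' | h'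
    · refine ⟨g, hg, ?_⟩
      convert h
      ext i
      simp [← h' i]
    · refine ⟨g * omegaBar k, mul_mem hg hω, ?_⟩
      have hp : Permutes (omegaBar k).1 (Equiv.neg ℤ) := CompAut.permutes _
      convert h.mul hp
      ext i
      simp [← h' i]
  obtain ⟨g, hg, h⟩ := this
  have h1 : Permutes (γ * g⁻¹).1 1 := by
    have := Permutes.mul hσ h.inv
    rwa [mul_inv_cancel] at this
  have h2 : γ * g⁻¹ ∈ G := Subgroup.subset_closure (Or.inl (mem_ker_of_permutes_one h1))
  simpa using mul_mem h2 hg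

theorem autToPic_range :
    (autToPic (grading k)).range = Subgroup.closure {omegaPic k, shiftPic (grading k)} := by
  rw [MonoidHom.range_eq_map, ← closure_ker_union_eq_top, MonoidHom.map_closure]
  apply le_antisymm
  · rw [Subgroup.closure_le]
    rintro _ ⟨γ, hγ | rfl | rfl, rfl⟩
    · rw [MonoidHom.mem_ker.1 hγ]; exact one_mem _
    · rw [autToPic_alpha]; exact Subgroup.subset_closure (by simp)
    · rw [autToPic_omegaBar]; exact Subgroup.subset_closure (by simp)
  · rw [Subgroup.closure_le]
    rintro g (hg | hg) <;> rw [hg]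
    · exact Subgroup.subset_closure ⟨omegaBar k, by simp, autToPic_omegaBar⟩
    · exact Subgroup.subset_closure ⟨alpha (grading k), by simp, autToPic_alpha⟩

/-! ### The module k[x] as a test object, and the dihedral structure -/

variable (k) in
/-- The components of the graded module `k[x]`: they are one-dimensional in nonnegative degrees and
zero in negative degrees. -/
def halfLineComp (i : ℤ) : Submodule k k := if 0 ≤ i then ⊤ else ⊥

theorem mem_halfLineComp {i : ℤ} {c : k} : c ∈ halfLineComp k i ↔ (i < 0 → c = 0) := by
  unfold halfLineComp
  split_ifs with h
  · simp [h]
  · simp [not_le.1 h]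

variable (k) in
/-- The graded right module `k[x]`, on which `x` acts by multiplication and `y` by derivation. -/
def halfLine : GrMod (grading k) where
  comp i := halfLineComp k i
  act i j := LinearMap.mk₂ k
    -- On k[x] the element xy sends xⁱ to (i + 1)xⁱ, so symbols are evaluated at i + 1, not at i.
    (fun c a => ⟨c * (symbol (a : Weyl k)).eval (i + 1 : k), by
      rw [mem_halfLineComp]
      intro hj
      rcases lt_or_ge i 0 with hi | hi
      · rw [mem_halfLineComp.1 c.2 hi, zero_mul]
      -- Differentiating xⁱ more than i times gives zero, so nothing lands in negative degrees.
      · rw [symbol_eval_eq_zero a.2 hi (by omega), mul_zero]⟩)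
    (fun c c' a => Subtype.ext (add_mul _ _ _))
    (fun r c a => Subtype.ext (mul_assoc _ _ _))
    (fun c a a' => Subtype.ext (by simp [mul_add]))
    (fun r c a => Subtype.ext (by simp [mul_left_comm]))
  act_one i c := Subtype.ext (by simp)
  act_mul i j l c a b := Subtype.ext (by
    simp only [LinearMap.mk₂_apply, ZAlg.coe_compMul, symbol_mul a.2, Polynomial.eval_mul,
      Polynomial.taylor_eval, mul_assoc]
    congr 3
    push_cast
    ring)

theorem nontrivial_halfLine_iff (i : ℤ) : Nontrivial ((halfLine k).comp i) ↔ 0 ≤ i := by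
  change Nontrivial (halfLineComp k i) ↔ _
  rw [Submodule.nontrivial_iff_ne_bot]
  unfold halfLineComp
  split_ifs with h <;> simp [h]

theorem nonneg_iff_of_equiv {i j : ℤ}
    (e : Nonempty ((halfLine k).comp i ≃ (halfLine k).comp j)) : 0 ≤ i ↔ 0 ≤ j := by
  obtain ⟨e⟩ := e
  rw [← nontrivial_halfLine_iff (k := k), ← nontrivial_halfLine_iff (k := k)]
  exact e.nontrivial_congr

theorem eq_zero_of_shiftPic_zpow_eq_one (n : ℤ) (h : shiftPic (grading k) ^ n = 1) : n = 0 := by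
  rw [shiftPic_zpow] at h
  have key : ∀ i : ℤ, 0 ≤ i + -n ↔ 0 ≤ i := fun i =>
    nonneg_iff_of_equiv (comp_equiv_of_pic_mk_eq h (halfLine k) i)
  have h1 := key 0
  have h2 := key n
  omega

theorem omegaPic_mul_shiftPic_zpow_ne_one (n : ℤ) : omegaPic k * shiftPic (grading k) ^ n ≠ 1 := by
  intro h
  rw [shiftPic_zpow, omegaPic, Pic.mk_mul_mk] at h
  have key : ∀ i : ℤ, 0 ≤ -i + -n ↔ 0 ≤ i := fun i =>
    nonneg_iff_of_equiv (comp_equiv_of_pic_mk_eq h (halfLine k) i)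
  -- This degree is nonnegative, but it is large enough for its reflection to be negative.
  have h1 := key (|n| + 1)
  have h2 := neg_abs_le n
  have h3 := abs_nonneg n
  omega

/-- The two dihedral relations are images under π of facts about the ℤ-algebra: ω̄² is inner and
αω̄α = ω̄. Only the absence of further relations needs the test module. -/
theorem nonempty_closure_mulEquiv :
    Nonempty (Subgroup.closure {omegaPic k, shiftPic (grading k)} ≃* DihedralGroup 0) := by
  refine nonempty_closure_mulEquiv_dihedralGroup _ _ ?_ ?_ eq_zero_of_shiftPic_zpow_eq_one
    omegaPic_mul_shiftPic_zpow_ne_one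
  · rw [← autToPic_omegaBar, ← map_mul]
    exact MonoidHom.mem_ker.1 omegaBar_mul_self_mem_ker
  · have h := congrArg (autToPic (grading k)) (alpha_mul_omegaBar_mul_alpha (k := k))
    rw [map_mul, map_mul, autToPic_alpha, autToPic_omegaBar, mul_assoc] at h
    refine eq_inv_of_mul_eq_one_right ?_
    rw [← mul_assoc, h, mul_inv_cancel]

end Weyl

end WeylPic

end

theorem corollary5p9 (k : Type u) [Field k] [IsAlgClosed k] [CharZero k] :
    (∀ i j : ℤ,
      (i ≤ j → (WeylPic.Weyl.omegaBar k).1 (WeylPic.Weyl.m k i j) =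
        WeylPic.Weyl.m k (-i) (-j)) ∧
      (j < i → (WeylPic.Weyl.omegaBar k).1 (WeylPic.Weyl.m k i j) =
        (-1 : k) ^ (i - j) • WeylPic.Weyl.m k (-i) (-j))) ∧
    Subgroup.closure
      (((WeylPic.autToPic (WeylPic.Weyl.grading k)).ker :
          Set (WeylPic.ZAut (WeylPic.Weyl.grading k))) ∪
        {WeylPic.alpha (WeylPic.Weyl.grading k), WeylPic.Weyl.omegaBar k}) = ⊤ ∧
    (WeylPic.autToPic (WeylPic.Weyl.grading k)).range =
      Subgroup.closure
        {WeylPic.Weyl.omegaPic k, WeylPic.shiftPic (WeylPic.Weyl.grading k)} ∧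
    Nonempty
      (Subgroup.closure
        {WeylPic.Weyl.omegaPic k, WeylPic.shiftPic (WeylPic.Weyl.grading k)} ≃*
          DihedralGroup 0) :=
  ⟨fun i j => ⟨WeylPic.Weyl.omegaBar_m i j, WeylPic.Weyl.omegaBar_m_of_lt i j⟩,
    WeylPic.Weyl.closure_ker_union_eq_top, WeylPic.Weyl.autToPic_range,
    WeylPic.Weyl.nonempty_closure_mulEquiv⟩
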